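/- Write $e(x)=e^{2\pi i x}$; for real $x$ let $\delta(x)=1$ if $x\in\mathbb{Z}$ and $\delta(x)=0$ otherwise, and let $\langle x\rangle'=1-\langle -x\rangle\in(0,1]$, where $\langle x\rangle=x-\lfloor x\rfloor$. Let $\alpha,\beta,\mu,\nu$ be real and let $z=i\tau$ with $\operatorname{Im}z>0$, i.e. $|\arg\tau|<\pi/2$; put $q=e(z)=e^{-2\pi\tau}$ and $q^x=e(xz)$ for real $x$. For $\operatorname{Re}s>2$ let $$F^{\pm}(s;z)=\sum_{\substack{m,n\in\mathbb{Z}\\ \alpha+m+(\beta+n)z\neq0}}\frac{e\{(\alpha+m)\mu+(\beta+n)\nu\}}{\{\alpha+m+(\beta+n)z\}^{s}},$$ where the argument of $\alpha+m+(\beta+n)z$ is taken in $(-\pi,\pi]$ for $F^+$ and in $[-\pi,\pi)$ for $F^-$, and let $F_{\mathbb{Z}^2}(s;\alpha,\beta;\mu,\nu;z)=\frac12\{F^+(s;z)+F^-(s;z)\}$. For real $\gamma,\kappa$ let $\psi(r,\gamma,\kappa)$ be the meromorphic continuation to $\mathbb{C}$ of $\sum_{k\in\mathbb{Z},\,k>-\gamma}e\{(\gamma+k)\kappa\}(\gamma+k)^{-r}$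 $(\operatorname{Re}r>1)$, which exists, is holomorphic for $r\neq1$, and is entire if $\kappa\notin\mathbb{Z}$. For real $\gamma,\delta,\kappa,\lambda$ let $$\mathcal{S}_r(\gamma,\delta;\kappa,\lambda;q)=\sum_{\substack{k,l\in\mathbb{Z}\\ k>-\gamma,\ l>-\delta}}\frac{e\{(\gamma+k)\kappa+(\delta+l)\lambda\}}{(\delta+l)^{r}}\,q^{(\gamma+k)(\delta+l)}.$$ (i) The function $$\mathcal{A}(s,\alpha,\mu)=\cos(\pi s)\psi(s,-\alpha,-\mu)+\psi(s,\alpha,\mu)=e(\alpha\mu)\frac{(2\pi)^s}{2\Gamma(s)}\bigl\{e^{-\pi is/2}\psi(1-s,-\mu,\alpha)+e^{\pi is/2}\psi(1-s,\mu,-\alpha)\bigr\}$$ is entire in $s$; the two expressions agree with it wherever the functions $\psi$ in them have no pole (the first except possibly at $s=1$ when $\mu\in\mathbb{Z}$, the second except possibly at $s=0$ when $\alpha\in\mathbb{Z}$), with the value at an exceptional point understood as the limit. (ii) The series for $F^{\pm}$ converge absolutely for $\operatorname{Re}s>2$, the series $\mathcal{S}_{1-s}(\beta,-\mu;\nu,\alpha;q)$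 and $\mathcal{S}_{1-s}(-\beta,\mu;-\nu,-\alpha;q)$ converge absolutely for all $s\in\mathbb{C}$, and $F_{\mathbb{Z}^2}$ has a holomorphic continuation to the whole $s$-plane, given for all $s\in\mathbb{C}$ by $$F_{\mathbb{Z}^2}(s;\alpha,\beta;\mu,\nu;z)=\delta(\beta)\mathcal{A}(s,\alpha,\mu)+e(\alpha\mu)\frac{(2\pi)^s}{\Gamma(s)}\bigl\{e^{-\pi is/2}\mathcal{S}_{1-s}(\beta,-\mu;\nu,\alpha;q)+e^{\pi is/2}\mathcal{S}_{1-s}(-\beta,\mu;-\nu,-\alpha;q)\bigr\}.$$ (iii) Let $(\gamma,\delta,\kappa,\lambda)$ be $(\beta,-\mu,\nu,\alpha)$ or $(-\beta,\mu,-\nu,-\alpha)$, and $r=1-s$. Then $$\mathcal{S}_r(\gamma,\delta;\kappa,\lambda;q)=\sum_{l>-\delta}T_l,\qquad T_l=e(\langle\gamma\rangle'\kappa)\frac{e\{(\delta+l)\lambda\}\,q^{\langle\gamma\rangle'(\delta+l)}}{(\delta+l)^{r}\{1-e(\kappa)q^{\delta+l}\}},$$ and this is an asymptotic series as $\tau\to\infty$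 through any sector $|\arg\tau|\le\theta$ with $\theta<\pi/2$: $T_l\asymp\exp\{-2\pi\langle\gamma\rangle'(\delta+l)\tau\}$ for each integer $l>-\delta$, and $\mathcal{S}_r-\sum_{-\delta<l\le L}T_l=O(\exp\{-2\pi\langle\gamma\rangle'(\delta+L+1)\tau\})$ for each integer $L\ge\lfloor-\delta\rfloor$ (orders refer to absolute values). Accordingly, if the two $q$-series in the formula of (ii) are replaced by their partial sums over $\mu<l\le L$ and $-\mu<l\le L'$ respectively (with integers $L\ge\lfloor\mu\rfloor$, $L'\ge\lfloor-\mu\rfloor$), the resulting approximation to $F_{\mathbb{Z}^2}(s;\alpha,\beta;\mu,\nu;i\tau)$ has, for each fixed $s\in\mathbb{C}$, the error $O(e^{-2\pi\langle\beta\rangle'(-\mu+L+1)\operatorname{Re}\tau}+e^{-2\pi\langle-\beta\rangle'(\mu+L'+1)\operatorname{Re}\tau})$ as $\tau\to\infty$ in such a sector. -/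

import Mathlib

open Complex Filter Asymptotics

namespace HolEis

noncomputable section

/-- `e(x) = exp(2πix)`. -/
def e (x : ℂ) : ℂ := exp (2 * Real.pi * I * x)

/-- `x` is an integer. -/
def IsInt (x : ℝ) : Prop := ∃ n : ℤ, x = n

open Classical in
/-- `δ(x) = 1` if `x` is an integer and `δ(x) = 0` otherwise. -/
def delta (x : ℝ) : ℂ := if IsInt x then 1 else 0

/-- `⟨x⟩' = 1 - ⟨-x⟩`, which lies in `(0, 1]`. -/
def fracPrime (x : ℝ) : ℝ := 1 - Int.fract (-x)

/-! ### The generalized holomorphic Eisenstein series -/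

/-- The lattice point `α + m + (β + n) z`. -/
def latticePt (α β : ℝ) (z : ℂ) (p : ℤ × ℤ) : ℂ := (α + p.1) + (β + p.2) * z

/-- The argument of `w` chosen in `[-π, π)`; recall that `Complex.arg` takes values in `(-π, π]`. -/
def argMinus (w : ℂ) : ℝ := if arg w = Real.pi then -Real.pi else arg w

/-- For `w ≠ 0`, the power `w ^ s` with the argument of `w` in `(-π, π]`. -/
def powPlus (w s : ℂ) : ℂ := exp (s * (Real.log ‖w‖ + arg w * I))

/-- For `w ≠ 0`, the power `w ^ s` with the argument of `w` in `[-π, π)`. -/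
def powMinus (w s : ℂ) : ℂ := exp (s * (Real.log ‖w‖ + argMinus w * I))

/-- The summands of the Eisenstein series, with respect to a choice `pow` of the powers. -/
def eisTerm (pow : ℂ → ℂ → ℂ) (s : ℂ) (α β μ ν : ℝ) (z : ℂ) (p : ℤ × ℤ) : ℂ :=
  e ((α + p.1) * μ + (β + p.2) * ν) / pow (latticePt α β z p) s

/-- The Eisenstein series, with respect to a choice `pow` of the powers; the term (if there is one)
with `α + m + (β + n) z = 0` is omitted. -/
def eisSeries (pow : ℂ → ℂ → ℂ) (s : ℂ) (α β μ ν : ℝ) (z : ℂ) : ℂ :=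
  ∑' p : {p : ℤ × ℤ // latticePt α β z p ≠ 0}, eisTerm pow s α β μ ν z p

/-- The mean of the Eisenstein series for the two choices of the branch (for `Re s > 2`). -/
def eisF (s : ℂ) (α β μ ν : ℝ) (z : ℂ) : ℂ :=
  (eisSeries powPlus s α β μ ν z + eisSeries powMinus s α β μ ν z) / 2

/-! ### The Lerch zeta-function `ψ` -/

/-- The summands `e((γ + k) κ) / (γ + k) ^ r` of `ψ(r, γ, κ)`. -/
def psiTerm (r : ℂ) (γ κ : ℝ) (k : ℤ) : ℂ :=
  e ((γ + k) * κ) / ((γ + k : ℝ) : ℂ) ^ r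

/-- `f` is the meromorphic continuation to the plane of the function
`ψ(r, γ, κ) = ∑_{k > -γ} e((γ + k) κ) / (γ + k) ^ r` on `Re r > 1`: it is holomorphic away from
`r = 1`, and entire if `κ` is not an integer. By the identity theorem these properties determine
`f r` for all `r ≠ 1`, and for `r = 1` too if `κ` is not an integer. -/
structure IsLerchPsi (γ κ : ℝ) (f : ℂ → ℂ) : Prop where
  hasSum : ∀ r : ℂ, 1 < r.re → HasSum (fun k : {k : ℤ // -γ < k} => psiTerm r γ κ k) (f r)
  differentiableOn : DifferentiableOn ℂ f {1}ᶜ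
  meromorphicAt : MeromorphicAt f 1
  entire : ¬ IsInt κ → Differentiable ℂ f

/-- The Lerch zeta-function `ψ(r, γ, κ)`, as a meromorphic function of `r`. -/
def lerchPsi (r : ℂ) (γ κ : ℝ) : ℂ := Classical.epsilon (IsLerchPsi γ κ) r

/-- `cos(πs) ψ(s, -α, -μ) + ψ(s, α, μ)`. -/
def calA₀ (s : ℂ) (α μ : ℝ) : ℂ :=
  cos (Real.pi * s) * lerchPsi s (-α) (-μ) + lerchPsi s α μ

/-- `𝓐(s, α, μ) = cos(πs) ψ(s, -α, -μ) + ψ(s, α, μ)`, where the value at `s = 1`, at which both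
summands may have a pole, is understood as the limit. -/
def calA (s : ℂ) (α μ : ℝ) : ℂ :=
  Function.update (fun w => calA₀ w α μ) 1 (limUnder (nhdsWithin 1 {1}ᶜ) fun w => calA₀ w α μ) s

/-! ### The `q`-series -/

/-- The summands of the double series `𝓢_r(γ, δ; κ, lam; q)` with `q = e(z)`, where the power `q ^ x`
for real `x` means `e(x z)`. -/
def qTerm (r : ℂ) (γ δ κ lam : ℝ) (z : ℂ) (k l : ℤ) : ℂ :=
  e ((γ + k) * κ + (δ + l) * lam) / ((δ + l : ℝ) : ℂ) ^ r * e ((γ + k) * (δ + l) * z)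

/-- The index set `k > -γ`, `l > -δ` of the double series. -/
abbrev QIndex (γ δ : ℝ) : Type := {k : ℤ // -γ < k} × {l : ℤ // -δ < l}

/-- The `q`-series `𝓢_r(γ, δ; κ, lam; q)` with `q = e(z)`. -/
def qSeries (r : ℂ) (γ δ κ lam : ℝ) (z : ℂ) : ℂ :=
  ∑' p : QIndex γ δ, qTerm r γ δ κ lam z p.1 p.2

/-- The summands of the `q`-series after summation over `k`:
`e(⟨γ⟩' κ) e((δ + l) lam) q ^ (⟨γ⟩' (δ + l)) / ((δ + l) ^ r (1 - e(κ) q ^ (δ + l)))`. -/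
def qTermSum (r : ℂ) (γ δ κ lam : ℝ) (z : ℂ) (l : ℤ) : ℂ :=
  e (fracPrime γ * κ) * (e ((δ + l) * lam) * e (fracPrime γ * (δ + l) * z)) /
    (((δ + l : ℝ) : ℂ) ^ r * (1 - e κ * e ((δ + l) * z)))

/-- `∑_{-δ < l ≤ L}` of the preceding summands. -/
def qPartialSum (r : ℂ) (γ δ κ lam : ℝ) (z : ℂ) (L : ℤ) : ℂ :=
  ∑ l ∈ Finset.Ioc ⌊-δ⌋ L, qTermSum r γ δ κ lam z l

/-- `τ → ∞` through the sector `|arg τ| ≤ θ`. -/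
def atInftySector (θ : ℝ) : Filter ℂ :=
  Bornology.cobounded ℂ ⊓ Filter.principal {τ : ℂ | |arg τ| ≤ θ}

/-- With `q = e(z)`, `z = iτ`, the `q`-series is a convergent asymptotic series as `τ → ∞` in
`|arg τ| < π / 2`: it is the sum of the series over `l`; the term with index `l` has exact order
`exp(-2π ⟨γ⟩' (δ + l) τ)`, and the error after the terms up to `L` is of the order of the first
omitted term. -/
structure IsAsymptoticQSeries (r : ℂ) (γ δ κ lam : ℝ) : Prop where
  hasSum : ∀ z : ℂ, 0 < z.im →
    HasSum (fun l : {l : ℤ // -δ < l} => qTermSum r γ δ κ lam z l) (qSeries r γ δ κ lam z)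
  order : ∀ θ < Real.pi / 2, ∀ l : ℤ, -δ < l →
    (fun τ : ℂ => qTermSum r γ δ κ lam (I * τ) l) =Θ[atInftySector θ]
      fun τ : ℂ => exp (-2 * Real.pi * fracPrime γ * (δ + l) * τ)
  remainder : ∀ θ < Real.pi / 2, ∀ L : ℤ, ⌊-δ⌋ ≤ L →
    (fun τ : ℂ => qSeries r γ δ κ lam (I * τ) - qPartialSum r γ δ κ lam (I * τ) L)
      =O[atInftySector θ]
      fun τ : ℂ => exp (-2 * Real.pi * fracPrime γ * (δ + (L + 1)) * τ)

end

end HolEis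

open HolEis

/-! Split the lattice sum into rows of constant `n`. A row with `β + n > 0` lies in the upper
half-plane, and Lipschitz's formula (`hasSum_lipschitz`) turns its sum over `m` into an exponential
series over `l`; summing over `n` gives the first `q`-series. A row with `β + n < 0` is reflected
through the origin, at the cost of a factor `exp (πis)`, and gives the second. The two branches
differ only on the negative real axis, hence only in the row `β + n = 0`, if there is one; there
their mean puts the weight `cos (πs)` on the negative points, and the row sums to `𝓐`. All three
contributions are entire in `s`, so their sum `eisCont` is the continuation (`eisCont_eq_eisF`,
`differentiable_eisCont`).

Lipschitz's formula is Poisson summation for `y ^ (s - 1) e(yw)` on the half-line, whose Fourier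
transform is a Gamma integral.

For `𝓐`, the series `ψ` is half the sum of an even and an odd two-sided Lerch series, both Mellin
transforms of theta kernels. By `calA₀_eq`, `𝓐` is `cos² (πs/2)` times the even plus `sin² (πs/2)`
times the odd function: the latter is entire, and the double zero of the cosine factor kills the
possible simple pole of the former at `s = 1`. Theta inversion gives the functional equations behind
the dual expression.

For the asymptotics, the sum over `k` is geometric, and the tail over `l` is dominated by its first
term uniformly in the sector, because `Re τ ≥ |τ| cos θ` there. -/

namespace HolEis

noncomputable section

open Topology Set MeasureTheory

/-! ### The exponential `e` and the index function `delta` -/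

lemma e_add (x y : ℂ) : e (x + y) = e x * e y := by
  simp only [e, mul_add, Complex.exp_add]

lemma e_neg (x : ℂ) : e (-x) = (e x)⁻¹ := by
  simp only [e, mul_neg, Complex.exp_neg]

lemma e_ne_zero (x : ℂ) : e x ≠ 0 := Complex.exp_ne_zero _

lemma e_zero : e 0 = 1 := by simp [e]

lemma norm_e (x : ℂ) : ‖e x‖ = Real.exp (-(2 * Real.pi * x.im)) := by
  rw [e, Complex.norm_exp]
  congr 1
  simp

lemma norm_e_ofReal (x : ℝ) : ‖e x‖ = 1 := by simp [norm_e]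

lemma delta_of_isInt {x : ℝ} (h : IsInt x) : delta x = 1 := if_pos h

lemma delta_of_not_isInt {x : ℝ} (h : ¬ IsInt x) : delta x = 0 := if_neg h

lemma IsInt.neg {x : ℝ} (h : IsInt x) : IsInt (-x) := by
  obtain ⟨n, rfl⟩ := h
  exact ⟨-n, by simp⟩

lemma isInt_neg {x : ℝ} : IsInt (-x) ↔ IsInt x :=
  ⟨fun h => by simpa using h.neg, IsInt.neg⟩

lemma delta_neg (x : ℝ) : delta (-x) = delta x := by
  by_cases h : IsInt x
  · rw [delta_of_isInt h, delta_of_isInt h.neg]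
  · rw [delta_of_not_isInt h, delta_of_not_isInt (isInt_neg.not.mpr h)]

/-! ### Theta kernels with two characteristics -/

/-- The kernel `∑ n, e((a + n) b) exp(-π (a + n) ^ 2 t)`. -/
def evenThetaKernel (a b t : ℝ) : ℂ :=
  e (a * b) * exp (-Real.pi * a ^ 2 * t) * jacobiTheta₂ (b + a * I * t) (I * t)

/-- The kernel `∑ n, e((a + n) b) (a + n) exp(-π (a + n) ^ 2 t)`. -/
def oddThetaKernel (a b t : ℝ) : ℂ :=
  e (a * b) * exp (-Real.pi * a ^ 2 * t) *
    (jacobiTheta₂' (b + a * I * t) (I * t) / (2 * Real.pi * I) +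
      a * jacobiTheta₂ (b + a * I * t) (I * t))

/-- Completing the square in the exponent. -/
lemma theta_term_eq (a b t : ℝ) (n : ℤ) :
    e (a * b) * exp (-Real.pi * a ^ 2 * t) * jacobiTheta₂_term n (b + a * I * t) (I * t) =
      e ((n + a : ℝ) * b) * Real.exp (-Real.pi * (n + a) ^ 2 * t) := by
  rw [jacobiTheta₂_term, e, e, ofReal_exp, ← Complex.exp_add, ← Complex.exp_add,
    ← Complex.exp_add]
  congr 1
  push_cast
  linear_combination (2 * Real.pi * n * a * t + Real.pi * n ^ 2 * t : ℂ) * I_mul_I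

lemma hasSum_evenThetaKernel (a b : ℝ) {t : ℝ} (ht : 0 < t) :
    HasSum (fun n : ℤ => e ((n + a : ℝ) * b) * Real.exp (-Real.pi * (n + a) ^ 2 * t))
      (evenThetaKernel a b t) := by
  simp_rw [← theta_term_eq]
  exact (hasSum_jacobiTheta₂_term _ (by simpa)).mul_left _

lemma hasSum_oddThetaKernel (a b : ℝ) {t : ℝ} (ht : 0 < t) :
    HasSum (fun n : ℤ => e ((n + a : ℝ) * b) * (n + a : ℝ) *
      Real.exp (-Real.pi * (n + a) ^ 2 * t)) (oddThetaKernel a b t) := by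
  have h1 := hasSum_jacobiTheta₂_term (b + a * I * t : ℂ) (τ := I * t) (by simpa)
  have h2 := hasSum_jacobiTheta₂'_term (b + a * I * t : ℂ) (τ := I * t) (by simpa)
  refine (((h2.div_const (2 * Real.pi * I)).add (h1.mul_left ↑a)).mul_left
    (e (a * b) * exp (-Real.pi * a ^ 2 * t))).congr_fun (fun n => ?_)
  rw [mul_right_comm, ← theta_term_eq, jacobiTheta₂'_term, mul_assoc (2 * Real.pi * I : ℂ),
    mul_div_cancel_left₀ _ two_pi_I_ne_zero]
  push_cast
  ring

lemma continuousOn_evenThetaKernel (a b : ℝ) : ContinuousOn (evenThetaKernel a b) (Ioi 0) := by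
  refine continuousOn_of_forall_continuousAt fun x hx => .mul (by fun_prop) ?_
  exact (continuousAt_jacobiTheta₂ (b + a * I * x) <| by simpa).comp
    (f := fun u : ℝ => ((b + a * I * u : ℂ), I * (u : ℂ))) (by fun_prop)

lemma continuousOn_oddThetaKernel (a b : ℝ) : ContinuousOn (oddThetaKernel a b) (Ioi 0) := by
  refine continuousOn_of_forall_continuousAt fun x hx => .mul (by fun_prop) (.add ?_ (.mul ?_ ?_))
  · exact ((continuousAt_jacobiTheta₂' (b + a * I * x) <| by simpa).comp
      (f := fun u : ℝ => ((b + a * I * u : ℂ), I * (u : ℂ))) (by fun_prop)).div_const _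
  · fun_prop
  · exact (continuousAt_jacobiTheta₂ (b + a * I * x) <| by simpa).comp
      (f := fun u : ℝ => ((b + a * I * u : ℂ), I * (u : ℂ))) (by fun_prop)

/-! ### Inversion `t ↦ 1 / t` of the theta kernels. -/

section inversion

variable (a b : ℝ) {t : ℝ} (ht : 0 < t)
include ht

lemma one_div_neg_I_mul_cpow :
    1 / (-I * (I * (1 / t : ℝ))) ^ (1 / 2 : ℂ) = ((t ^ (1 / 2 : ℝ) : ℝ) : ℂ) := by
  rw [← mul_assoc, neg_mul, I_mul_I, neg_neg, one_mul,
    show (1 / 2 : ℂ) = ((1 / 2 : ℝ) : ℂ) by push_cast; rfl,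
    ← ofReal_cpow (by positivity), one_div t, Real.inv_rpow ht.le]
  simp

lemma div_I_mul_one_div :
    (b + a * I * (1 / t : ℝ)) / (I * (1 / t : ℝ)) = a + (-b : ℝ) * I * t := by
  have ht' : (t : ℂ) ≠ 0 := ofReal_ne_zero.mpr ht.ne'
  push_cast
  field_simp
  linear_combination ((b : ℂ) * t) * I_sq

lemma neg_one_div_I_mul_one_div : -1 / (I * (1 / t : ℝ)) = I * t := by
  have ht' : (t : ℂ) ≠ 0 := ofReal_ne_zero.mpr ht.ne'
  push_cast
  field_simp
  linear_combination -I_sq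

lemma jacobiTheta₂_inversion :
    jacobiTheta₂ (b + a * I * (1 / t : ℝ)) (I * (1 / t : ℝ)) =
      (t ^ (1 / 2 : ℝ) : ℝ) * exp (-Real.pi * I * (b + a * I * (1 / t : ℝ)) ^ 2 /
        (I * (1 / t : ℝ))) * jacobiTheta₂ (a + (-b : ℝ) * I * t) (I * t) := by
  rw [jacobiTheta₂_functional_equation, one_div_neg_I_mul_cpow ht, div_I_mul_one_div a b ht,
    neg_one_div_I_mul_one_div ht]

lemma jacobiTheta₂'_inversion :
    jacobiTheta₂' (b + a * I * (1 / t : ℝ)) (I * (1 / t : ℝ)) =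
      (t ^ (1 / 2 : ℝ) : ℝ) * exp (-Real.pi * I * (b + a * I * (1 / t : ℝ)) ^ 2 /
        (I * (1 / t : ℝ))) * (-I * t) * (jacobiTheta₂' (a + (-b : ℝ) * I * t) (I * t) -
          2 * Real.pi * I * (b + a * I * (1 / t : ℝ)) *
            jacobiTheta₂ (a + (-b : ℝ) * I * t) (I * t)) := by
  have ht' : (t : ℂ) ≠ 0 := ofReal_ne_zero.mpr ht.ne'
  have h4 (x y : ℂ) : x / (I * (1 / t : ℝ)) * y = x * (-I * t) * y := by
    push_cast
    field_simp
    linear_combination (x * y) * I_sq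
  rw [jacobiTheta₂'_functional_equation, one_div_neg_I_mul_cpow ht, div_I_mul_one_div a b ht,
    neg_one_div_I_mul_one_div ht, h4]

lemma exp_inversion :
    exp (-Real.pi * a ^ 2 * (1 / t : ℝ)) * exp (-Real.pi * I * (b + a * I * (1 / t : ℝ)) ^ 2 /
        (I * (1 / t : ℝ))) = e ((-b : ℝ) * a) * exp (-Real.pi * (-b : ℝ) ^ 2 * t) := by
  have ht' : (t : ℂ) ≠ 0 := ofReal_ne_zero.mpr ht.ne'
  rw [e, ← Complex.exp_add, ← Complex.exp_add]
  congr 1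
  push_cast
  field_simp
  linear_combination (-a^2 : ℂ) * I_sq

lemma evenThetaKernel_inversion :
    evenThetaKernel a b (1 / t) =
      e (a * b) * (t ^ (1 / 2 : ℝ) : ℝ) * evenThetaKernel (-b) a t := by
  have h := exp_inversion a b ht
  rw [evenThetaKernel, evenThetaKernel, jacobiTheta₂_inversion a b ht]
  linear_combination (e (a * b) * (t ^ (1 / 2 : ℝ) : ℝ) *
    jacobiTheta₂ (a + (-b : ℝ) * I * t) (I * t)) * h

/-- The extra theta term in the functional equation of `jacobiTheta₂'` cancels the summand with
coefficient `a` and leaves the coefficient `-b` that the new characteristics require. The factor `t`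
that comes with it raises the weight from `1 / 2` to `3 / 2`. -/
lemma oddThetaKernel_inversion :
    oddThetaKernel a b (1 / t) =
      (-I * e (a * b)) * (t ^ (3 / 2 : ℝ) : ℝ) * oddThetaKernel (-b) a t := by
  have ht' : (t : ℂ) ≠ 0 := ofReal_ne_zero.mpr ht.ne'
  have h := exp_inversion a b ht
  have h5 : ((t ^ (3 / 2 : ℝ) : ℝ) : ℂ) = (t ^ (1 / 2 : ℝ) : ℝ) * t := by
    rw [← ofReal_mul, ← Real.rpow_add_one ht.ne']
    norm_num
  rw [oddThetaKernel, oddThetaKernel, jacobiTheta₂_inversion a b ht,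
    jacobiTheta₂'_inversion a b ht, h5]
  generalize exp (-Real.pi * I * (b + a * I * (1 / t : ℝ)) ^ 2 / (I * (1 / t : ℝ))) = X at *
  generalize exp (-Real.pi * a ^ 2 * (1 / t : ℝ)) = Y at *
  generalize jacobiTheta₂ (a + (-b : ℝ) * I * t) (I * t) = J
  generalize jacobiTheta₂' (a + (-b : ℝ) * I * t) (I * t) = J'
  have hpi : (Real.pi : ℂ) ≠ 0 := ofReal_ne_zero.mpr Real.pi_ne_zero
  rw [show (-I * e (a * b) * (((t ^ (1 / 2 : ℝ) : ℝ) : ℂ) * t) *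
    (e (↑(-b) * ↑a) * exp (-↑Real.pi * ↑(-b) ^ 2 * ↑t) * (J' / (2 * ↑Real.pi * I) + ↑(-b) * J))) =
    (-I * e (a * b) * (((t ^ (1 / 2 : ℝ) : ℝ) : ℂ) * t) * (J' / (2 * ↑Real.pi * I) + ↑(-b) * J)) *
    (e (↑(-b) * ↑a) * exp (-↑Real.pi * ↑(-b) ^ 2 * ↑t)) by ring, ← h]
  push_cast
  field_simp
  ring_nf
  simp only [I_sq]
  ring

end inversion

/-! ### Decay of the kernels, and the Lerch series as Mellin transforms. -/

lemma hasSum_evenThetaKernel_sub_delta (a b : ℝ) {t : ℝ} (ht : 0 < t) :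
    HasSum (fun n : ℤ => if (n + a : ℝ) = 0 then 0 else
      e ((n + a : ℝ) * b) * Real.exp (-Real.pi * (n + a) ^ 2 * t))
      (evenThetaKernel a b t - delta a) := by
  by_cases h : IsInt a
  · rw [delta_of_isInt h]
    obtain ⟨k, rfl⟩ := h
    simpa [← Int.cast_add, add_eq_zero_iff_eq_neg, e_zero]
      using hasSum_ite_sub_hasSum (hasSum_evenThetaKernel k b ht) (-k)
  · have h' (n : ℤ) : (n + a : ℝ) ≠ 0 := fun h0 => h ⟨-n, by push_cast; linarith⟩
    simpa only [h', if_false, delta_of_not_isInt h, sub_zero] using hasSum_evenThetaKernel a b ht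

/-- The characters have modulus 1, so the kernel is majorised termwise by the one with `b = 0`,
whose exponential decay is known. -/
lemma isBigO_evenThetaKernel_sub (a b : ℝ) (r : ℝ) :
    (fun t => evenThetaKernel a b t - delta a) =O[atTop] fun t : ℝ => t ^ r := by
  obtain ⟨p, hp, hp'⟩ := HurwitzZeta.isBigO_atTop_evenKernel_sub (a : UnitAddCircle)
  refine (IsBigO.trans (Eventually.isBigO ?_) hp').trans
    (isLittleO_exp_neg_mul_rpow_atTop hp _).isBigO
  filter_upwards [eventually_gt_atTop 0] with t ht
  rw [← (hasSum_evenThetaKernel_sub_delta a b ht).tsum_eq]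
  refine tsum_of_norm_bounded (HurwitzZeta.hasSum_int_evenKernel₀ a ht) fun n => ?_
  split_ifs
  · simp
  · rw [norm_mul, ← ofReal_mul, norm_e_ofReal, one_mul, norm_real, Real.norm_of_nonneg
      (Real.exp_pos _).le]

lemma isBigO_oddThetaKernel (a b : ℝ) (r : ℝ) :
    oddThetaKernel a b =O[atTop] fun t : ℝ => t ^ r := by
  obtain ⟨p, hp, hp'⟩ := HurwitzKernelBounds.isBigO_atTop_F_int_one (a : UnitAddCircle)
  refine (IsBigO.trans (Eventually.isBigO ?_) hp').trans
    (isLittleO_exp_neg_mul_rpow_atTop hp _).isBigO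
  filter_upwards [eventually_gt_atTop 0] with t ht
  rw [← (hasSum_oddThetaKernel a b ht).tsum_eq]
  refine (norm_tsum_le_tsum_norm (hasSum_oddThetaKernel a b ht).summable.norm).trans (le_of_eq ?_)
  simp only [HurwitzKernelBounds.F_int, Function.Periodic.lift_coe]
  refine tsum_congr fun n => ?_
  rw [norm_mul, norm_mul, ← ofReal_mul, norm_e_ofReal, one_mul, norm_real, norm_real,
    Real.norm_of_nonneg (Real.exp_pos _).le, HurwitzKernelBounds.f_int, pow_one, Real.norm_eq_abs]

/-- The pair of even kernels with characteristics `(a, b)` and `(-b, a)`. -/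
@[simps]
def evenPair (a b : ℝ) : WeakFEPair ℂ where
  f := evenThetaKernel a b
  g := evenThetaKernel (-b) a
  k := 1 / 2
  ε := e (a * b)
  f₀ := delta a
  g₀ := delta (-b)
  hf_int := (continuousOn_evenThetaKernel a b).locallyIntegrableOn measurableSet_Ioi
  hg_int := (continuousOn_evenThetaKernel (-b) a).locallyIntegrableOn measurableSet_Ioi
  hk := one_half_pos
  hε := e_ne_zero _
  h_feq _ hx := evenThetaKernel_inversion a b hx
  hf_top := isBigO_evenThetaKernel_sub a b
  hg_top := isBigO_evenThetaKernel_sub (-b) a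

/-- The pair of odd kernels with characteristics `(a, b)` and `(-b, a)`. -/
@[simps]
def oddPair (a b : ℝ) : WeakFEPair ℂ where
  f := oddThetaKernel a b
  g := oddThetaKernel (-b) a
  k := 3 / 2
  ε := -I * e (a * b)
  f₀ := 0
  g₀ := 0
  hf_int := (continuousOn_oddThetaKernel a b).locallyIntegrableOn measurableSet_Ioi
  hg_int := (continuousOn_oddThetaKernel (-b) a).locallyIntegrableOn measurableSet_Ioi
  hk := by norm_num
  hε := mul_ne_zero (neg_ne_zero.mpr I_ne_zero) (e_ne_zero _)
  h_feq _ hx := oddThetaKernel_inversion a b hx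
  hf_top := by simpa using isBigO_oddThetaKernel a b
  hg_top := by simpa using isBigO_oddThetaKernel (-b) a

/-- The two pairs themselves differ, since the second kernel of `evenPair (-b) a` has
characteristics `(-a, -b)` and not `(a, b)`. But `Λ` depends on the second kernel only through its
constant term. -/
lemma evenPair_symm_Λ (a b : ℝ) (s : ℂ) : (evenPair a b).symm.Λ s = (evenPair (-b) a).Λ s := by
  have hε : (e (a * b))⁻¹ = e (((-b : ℝ) : ℂ) * a) := by
    rw [← e_neg]
    congr 1
    push_cast
    ring
  simp only [WeakFEPair.Λ, WeakFEPair.Λ₀, WeakFEPair.f_modif, WeakFEPair.symm_f, WeakFEPair.symm_k,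
    WeakFEPair.symm_ε, WeakFEPair.symm_f₀, WeakFEPair.symm_g₀, evenPair_f, evenPair_g, evenPair_k,
    evenPair_ε, evenPair_f₀, evenPair_g₀, hε, delta_neg a]

lemma oddPair_symm_Λ (a b : ℝ) (s : ℂ) : (oddPair a b).symm.Λ s = (oddPair (-b) a).Λ s := by
  simp only [WeakFEPair.Λ, WeakFEPair.Λ₀, WeakFEPair.f_modif, WeakFEPair.symm_f, WeakFEPair.symm_k,
    WeakFEPair.symm_f₀, WeakFEPair.symm_g₀, oddPair_f, oddPair_g, oddPair_k,
    oddPair_f₀, oddPair_g₀, smul_zero]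

/-- The function `∑ n, e((a + n) b) / |a + n| ^ s`, continued to the plane. -/
def evenLerch (a b : ℝ) (s : ℂ) : ℂ :=
  ((evenPair a b).Λ₀ (s / 2) - 2 * e (a * b) * delta b / (1 - s)) * (Gammaℝ s)⁻¹ -
    delta a / Real.pi * (Gammaℝ (s + 2))⁻¹

/-- The function `∑ n, e((a + n) b) sign (a + n) / |a + n| ^ s`, continued to the plane. -/
def oddLerch (a b : ℝ) (s : ℂ) : ℂ :=
  (oddPair a b).Λ ((s + 1) / 2) * (Gammaℝ (s + 1))⁻¹

/-- Since `Gammaℝ (s + 2) = Gammaℝ s * s / (2π)`, the polar term of `Λ` at `0` divided by `Gammaℝ s`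
is an entire function. Writing it so in the definition makes `evenLerch` holomorphic at `s = 0`,
where the product on the right has no direct meaning. -/
lemma evenLerch_eq (a b : ℝ) {s : ℂ} (hs : s ≠ 0) :
    evenLerch a b s = (evenPair a b).Λ (s / 2) * (Gammaℝ s)⁻¹ := by
  have hpi : (Real.pi : ℂ) ≠ 0 := ofReal_ne_zero.mpr Real.pi_ne_zero
  have h1 : 2 * e (a * b) * delta b / (1 - s) = e (a * b) / (((1 / 2 : ℝ) : ℂ) - s / 2) * delta b := by
    rw [show (((1 / 2 : ℝ) : ℂ) - s / 2) = (1 - s) / 2 by push_cast; ring, div_div_eq_mul_div]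
    ring
  rw [evenLerch, WeakFEPair.Λ, Gammaℝ_add_two hs, h1]
  simp only [evenPair_f₀, evenPair_g₀, evenPair_ε, evenPair_k, smul_eq_mul, delta_neg]
  field_simp
  ring

lemma differentiableAt_evenLerch (a b : ℝ) {s : ℂ} (hs : s ≠ 1 ∨ ¬ IsInt b) :
    DifferentiableAt ℂ (evenLerch a b) s := by
  have h0 : DifferentiableAt ℂ (fun s => (evenPair a b).Λ₀ (s / 2)) s :=
    ((evenPair a b).differentiable_Λ₀.comp (differentiable_id.div_const _)).differentiableAt
  have h1 : DifferentiableAt ℂ (fun s => 2 * e (a * b) * delta b / (1 - s)) s := by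
    rcases hs with hs | hs
    · exact (differentiableAt_const _).div (by fun_prop) (sub_ne_zero.mpr hs.symm)
    · simp [delta_of_not_isInt hs]
  exact ((h0.sub h1).mul differentiable_Gammaℝ_inv.differentiableAt).sub
    ((differentiableAt_const _).mul
      (differentiable_Gammaℝ_inv.comp (differentiable_id.add_const 2)).differentiableAt)

lemma differentiable_oddLerch (a b : ℝ) : Differentiable ℂ (oddLerch a b) := by
  refine Differentiable.mul (fun s => ?_)
    (differentiable_Gammaℝ_inv.comp (differentiable_id.add_const 1))
  exact ((oddPair a b).differentiableAt_Λ (.inr rfl) (.inr rfl)).comp s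
    (f := fun s => (s + 1) / 2) (by fun_prop)

/-- The singularity at `s = 1` is at most a simple pole; this is all that removing the singularity
of `calA₀` needs. -/
lemma tendsto_sub_one_mul_evenLerch (a b : ℝ) : ∃ c : ℂ,
    Tendsto (fun s => (s - 1) * evenLerch a b s) (𝓝[≠] 1) (𝓝 c) := by
  let g : ℂ → ℂ := fun s => ((s - 1) * (evenPair a b).Λ₀ (s / 2) + 2 * e (a * b) * delta b) *
    (Gammaℝ s)⁻¹ - (s - 1) * (delta a / Real.pi * (Gammaℝ (s + 2))⁻¹)
  have hg : Continuous g := by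
    have h0 : Continuous (fun s => (evenPair a b).Λ₀ (s / 2)) :=
      (evenPair a b).differentiable_Λ₀.continuous.comp (by fun_prop)
    have h1 := differentiable_Gammaℝ_inv.continuous
    have h2 : Continuous fun s => (Gammaℝ (s + 2))⁻¹ := h1.comp (continuous_id.add_const 2)
    fun_prop
  refine ⟨g 1, ((hg.tendsto 1).mono_left nhdsWithin_le_nhds).congr' ?_⟩
  filter_upwards [self_mem_nhdsWithin] with s hs
  have hs' : 1 - s ≠ 0 := sub_ne_zero.mpr (Ne.symm hs)
  simp only [g, evenLerch]
  field_simp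
  ring

lemma summable_norm_e_div (a b : ℝ) {σ : ℝ} (hσ : 1 < σ) :
    Summable fun n : ℤ => ‖e ((n + a : ℝ) * b)‖ / |(n + a : ℝ)| ^ σ := by
  refine ((Real.summable_one_div_int_add_rpow a σ).mpr hσ).congr fun n => ?_
  rw [← ofReal_mul, norm_e_ofReal]

lemma hasSum_evenLerch (a b : ℝ) {s : ℂ} (hs : 1 < s.re) :
    HasSum (fun n : ℤ => e ((n + a : ℝ) * b) / ((|n + a| : ℝ) : ℂ) ^ s) (evenLerch a b s) := by
  have hs0 : s ≠ 0 := fun h => by norm_num [h] at hs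
  have hG : Gammaℝ s ≠ 0 := Gammaℝ_ne_zero_of_re_pos (by linarith)
  have h := hasSum_mellin_pi_mul_sq (a := fun n : ℤ => e ((n + a : ℝ) * b))
    (r := fun n : ℤ => (n + a : ℝ)) (F := fun t => evenThetaKernel a b t - delta a) (s := s)
    (by linarith) (fun t ht => by simpa using! hasSum_evenThetaKernel_sub_delta a b ht)
    (summable_norm_e_div a b hs)
  have h2 := ((evenPair a b).hasMellin (s := s / 2) (by simpa using by linarith)).2
  simp only [evenPair_f, evenPair_f₀] at h2
  rw [h2] at h
  rw [evenLerch_eq a b hs0]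
  refine (h.mul_right (Gammaℝ s)⁻¹).congr_fun fun n => ?_
  field_simp

lemma hasSum_oddLerch (a b : ℝ) {s : ℂ} (hs : 1 < s.re) :
    HasSum (fun n : ℤ => e ((n + a : ℝ) * b) * SignType.sign (n + a : ℝ) /
      ((|n + a| : ℝ) : ℂ) ^ s) (oddLerch a b s) := by
  have hG : Gammaℝ (s + 1) ≠ 0 := Gammaℝ_ne_zero_of_re_pos (by simp; linarith)
  have h := hasSum_mellin_pi_mul_sq' (a := fun n : ℤ => e ((n + a : ℝ) * b))
    (r := fun n : ℤ => (n + a : ℝ)) (F := oddThetaKernel a b) (s := s)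
    (by linarith) (fun t ht => by simpa using! hasSum_oddThetaKernel a b ht)
    (summable_norm_e_div a b hs)
  have h2 : mellin (oddThetaKernel a b) ((s + 1) / 2) = (oddPair a b).Λ ((s + 1) / 2) :=
    (IsStrongFEPair.hasMellin (P := oddPair a b) ⟨rfl, rfl⟩ ((s + 1) / 2)).2
  rw [h2] at h
  refine (h.mul_right (Gammaℝ (s + 1))⁻¹).congr_fun fun n => ?_
  field_simp

/-- The Mellin functional equation combined with the reflection formula for `Gammaℝ`. The half-plane
avoids all Gamma poles; the identity theorem later extends the consequences. -/
lemma evenLerch_one_sub (a b : ℝ) {s : ℂ} (hs : 1 < s.re) :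
    e (a * b) * evenLerch (-b) a (1 - s) =
      Gammaℂ s * cos (Real.pi * s / 2) * evenLerch a b s := by
  have hs0 : s ≠ 0 := fun h => by norm_num [h] at hs
  have hs1 : 1 - s ≠ 0 := fun h => by rw [← sub_eq_zero.mp h] at hs; simp at hs
  have hn (n : ℕ) : s ≠ -n := fun h => by
    have := Nat.cast_nonneg (α := ℝ) n
    simp [h] at hs
    linarith
  have h := (evenPair a b).functional_equation ((1 - s) / 2)
  rw [evenPair_symm_Λ, evenPair_k, evenPair_ε, smul_eq_mul,
    show ((1 / 2 : ℝ) : ℂ) - (1 - s) / 2 = s / 2 by push_cast; ring] at h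
  rw [evenLerch_eq _ _ hs0, evenLerch_eq _ _ hs1, inv_Gammaℝ_one_sub hn, h]
  ring

lemma oddLerch_one_sub (a b : ℝ) {s : ℂ} (hs : 1 < s.re) :
    -I * e (a * b) * oddLerch (-b) a (1 - s) =
      Gammaℂ s * sin (Real.pi * s / 2) * oddLerch a b s := by
  have hn (n : ℕ) : s ≠ -n := fun h => by
    have := Nat.cast_nonneg (α := ℝ) n
    simp [h] at hs
    linarith
  have h := (oddPair a b).functional_equation ((1 - s + 1) / 2)
  rw [oddPair_symm_Λ, oddPair_k, oddPair_ε, smul_eq_mul,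
    show ((3 / 2 : ℝ) : ℂ) - (1 - s + 1) / 2 = (s + 1) / 2 by push_cast; ring] at h
  rw [oddLerch, oddLerch, show Gammaℝ (1 - s + 1) = Gammaℝ (2 - s) by ring_nf,
    inv_Gammaℝ_two_sub hn, h]
  ring

/-! ### Lerch's zeta-function -/

/-- Identity theorem: a plane without one point is still connected. -/
lemma eq_of_eq_of_lt_re {f g : ℂ → ℂ} {c : ℂ} {x : ℝ} (hf : DifferentiableOn ℂ f {c}ᶜ)
    (hg : DifferentiableOn ℂ g {c}ᶜ) (h : ∀ s : ℂ, x < s.re → f s = g s) {s : ℂ} (hs : s ≠ c) :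
    f s = g s := by
  have hconn : IsPreconnected ({c}ᶜ : Set ℂ) :=
    (isConnected_compl_singleton_of_one_lt_rank (by simp) c).isPreconnected
  have hopen : IsOpen ({c}ᶜ : Set ℂ) := isOpen_compl_singleton
  -- A base point inside the half-plane and to the right of the puncture.
  set w : ℂ := ((max x c.re + 1 : ℝ) : ℂ) with hw
  have hwre : w.re = max x c.re + 1 := by simp [hw]
  have hwc : w ∈ ({c}ᶜ : Set ℂ) := fun h0 => by
    rw [mem_singleton_iff.mp h0] at hwre
    linarith [le_max_right x c.re]
  refine (hf.analyticOnNhd hopen).eqOn_of_preconnected_of_eventuallyEq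
    (hg.analyticOnNhd hopen) hconn hwc ?_ hs
  have : {s : ℂ | x < s.re} ∈ 𝓝 w :=
    (isOpen_lt continuous_const continuous_re).mem_nhds
      (show x < w.re by rw [hwre]; linarith [le_max_left x c.re])
  filter_upwards [this] with s hs using h s hs

lemma eq_of_eq_of_lt_re_of_differentiable {f g : ℂ → ℂ} {x : ℝ} (hf : Differentiable ℂ f)
    (hg : Differentiable ℂ g) (h : ∀ s : ℂ, x < s.re → f s = g s) (s : ℂ) : f s = g s :=
  -- Any puncture other than `s` would do.
  eq_of_eq_of_lt_re (c := s + 1) hf.differentiableOn hg.differentiableOn h (by simp)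

lemma evenLerch_neg_neg_of_one_lt (a b : ℝ) {s : ℂ} (hs : 1 < s.re) :
    evenLerch (-a) (-b) s = evenLerch a b s := by
  have h := (Equiv.neg ℤ).hasSum_iff.mpr (hasSum_evenLerch (-a) (-b) hs)
  refine (h.congr_fun fun n => ?_).unique (hasSum_evenLerch a b hs)
  have h1 : (((Equiv.neg ℤ) n : ℤ) : ℝ) + -a = -(n + a) := by simp; ring
  simp only [Function.comp_apply, h1, abs_neg]
  push_cast
  ring_nf

lemma oddLerch_neg_neg (a b : ℝ) (s : ℂ) : oddLerch (-a) (-b) s = -oddLerch a b s := by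
  refine eq_of_eq_of_lt_re_of_differentiable (x := 1) (differentiable_oddLerch _ _)
    (differentiable_oddLerch a b).neg (fun s hs => ?_) s
  have h := (Equiv.neg ℤ).hasSum_iff.mpr (hasSum_oddLerch (-a) (-b) hs)
  refine (h.congr_fun fun n => ?_).unique (hasSum_oddLerch a b hs).neg
  have h1 : (((Equiv.neg ℤ) n : ℤ) : ℝ) + -a = -(n + a) := by simp; ring
  simp only [Function.comp_apply, h1, abs_neg, Left.sign_neg]
  push_cast
  ring_nf

lemma evenLerch_neg_neg (a b : ℝ) {s : ℂ} (hs : s ≠ 1) :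
    evenLerch (-a) (-b) s = evenLerch a b s :=
  eq_of_eq_of_lt_re (c := 1) (x := 1)
    (fun _ h => (differentiableAt_evenLerch _ _ (.inl h)).differentiableWithinAt)
    (fun _ h => (differentiableAt_evenLerch _ _ (.inl h)).differentiableWithinAt)
    (fun _ => evenLerch_neg_neg_of_one_lt a b) hs

/-- The continuation of `ψ(r, γ, κ)` obtained from theta functions. -/
def lerchFun (γ κ : ℝ) (r : ℂ) : ℂ := (evenLerch γ κ r + oddLerch γ κ r) / 2

lemma differentiableAt_lerchFun (γ κ : ℝ) {r : ℂ} (hr : r ≠ 1 ∨ ¬ IsInt κ) :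
    DifferentiableAt ℂ (lerchFun γ κ) r :=
  ((differentiableAt_evenLerch γ κ hr).add (differentiable_oddLerch γ κ r)).div_const 2

lemma meromorphicAt_lerchFun (γ κ : ℝ) : MeromorphicAt (lerchFun γ κ) 1 := by
  have h0 : MeromorphicAt (fun s => (evenPair γ κ).Λ₀ (s / 2)) 1 :=
    ((evenPair γ κ).differentiable_Λ₀.comp
      (differentiable_id.div_const _)).analyticAt 1 |>.meromorphicAt
  have h1 : MeromorphicAt (fun s => (Gammaℝ s)⁻¹) 1 :=
    (differentiable_Gammaℝ_inv.analyticAt 1).meromorphicAt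
  have h2 : MeromorphicAt (fun s => (Gammaℝ (s + 2))⁻¹) 1 :=
    ((differentiable_Gammaℝ_inv.comp
      (differentiable_id.add_const 2)).analyticAt 1).meromorphicAt
  have h3 : MeromorphicAt (oddLerch γ κ) 1 :=
    ((differentiable_oddLerch γ κ).analyticAt 1).meromorphicAt
  unfold lerchFun evenLerch
  fun_prop

lemma isLerchPsi_lerchFun (γ κ : ℝ) : IsLerchPsi γ κ (lerchFun γ κ) where
  hasSum r hr := by
    have h := ((hasSum_evenLerch γ κ hr).add (hasSum_oddLerch γ κ hr)).div_const 2
    refine (hasSum_subtype_iff_indicator (s := {k : ℤ | -γ < k})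
      (f := fun k => psiTerm r γ κ k)).mpr (h.congr_fun fun k => ?_)
    -- In the half-sum of the even and odd series, positive `k + γ` count once and negative ones
    -- cancel. If `k + γ = 0`, both terms vanish because `0 ^ r = 0` for `r ≠ 0` and division by
    -- zero gives zero.
    by_cases hk : -γ < k
    · have hk' : 0 < (k + γ : ℝ) := by linarith
      rw [indicator_of_mem (show k ∈ {k : ℤ | -γ < k} from hk), psiTerm, abs_of_pos hk',
        sign_pos hk', add_comm γ (k : ℝ), add_comm (γ : ℂ) (k : ℂ), SignType.coe_one]
      push_cast
      ring
    · rw [indicator_of_notMem (show k ∉ {k : ℤ | -γ < k} from hk)]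
      rcases lt_or_eq_of_le (show (k + γ : ℝ) ≤ 0 by linarith) with hk' | hk'
      · rw [sign_neg hk', SignType.coe_neg_one]
        ring
      · have hr0 : r ≠ 0 := fun h => by norm_num [h] at hr
        simp [hk', hr0]
  differentiableOn _ h := (differentiableAt_lerchFun γ κ (.inl h)).differentiableWithinAt
  meromorphicAt := meromorphicAt_lerchFun γ κ
  entire h _ := differentiableAt_lerchFun γ κ (.inr h)

lemma isLerchPsi_lerchPsi (γ κ : ℝ) : IsLerchPsi γ κ fun r => lerchPsi r γ κ :=
  Classical.epsilon_spec (p := IsLerchPsi γ κ) ⟨_, isLerchPsi_lerchFun γ κ⟩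

/-- The function picked by `Classical.epsilon` is pinned down away from `r = 1` by its series; at `r
= 1` with `κ` an integer its value is arbitrary. -/
lemma lerchPsi_eq (γ κ : ℝ) {r : ℂ} (hr : r ≠ 1) : lerchPsi r γ κ = lerchFun γ κ r :=
  eq_of_eq_of_lt_re (c := 1) (x := 1) (isLerchPsi_lerchPsi γ κ).differentiableOn
    (isLerchPsi_lerchFun γ κ).differentiableOn (fun s hs =>
      ((isLerchPsi_lerchPsi γ κ).hasSum s hs).unique ((isLerchPsi_lerchFun γ κ).hasSum s hs)) hr

lemma differentiableAt_lerchPsi (γ κ : ℝ) {r : ℂ} (hr : r ≠ 1 ∨ ¬ IsInt κ) :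
    DifferentiableAt ℂ (fun r => lerchPsi r γ κ) r := by
  rcases hr with hr | hr
  · exact (isLerchPsi_lerchPsi γ κ).differentiableOn.differentiableAt
      (isOpen_compl_singleton.mem_nhds hr)
  · exact (isLerchPsi_lerchPsi γ κ).entire hr r

lemma lerchPsi_neg_neg (γ κ : ℝ) {r : ℂ} (hr : r ≠ 1) :
    lerchPsi r (-γ) (-κ) = (evenLerch γ κ r - oddLerch γ κ r) / 2 := by
  rw [lerchPsi_eq _ _ hr, lerchFun, evenLerch_neg_neg _ _ hr, oddLerch_neg_neg, sub_eq_add_neg]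

/-! ### The function `𝓐` -/

/-- Half-angle formulas applied to `(1 ± cos (πs)) / 2`. -/
lemma calA₀_eq (α μ : ℝ) {s : ℂ} (hs : s ≠ 1) :
    calA₀ s α μ = cos (Real.pi * s / 2) ^ 2 * evenLerch α μ s +
      sin (Real.pi * s / 2) ^ 2 * oddLerch α μ s := by
  rw [calA₀, lerchPsi_neg_neg _ _ hs, lerchPsi_eq _ _ hs, lerchFun,
    show (Real.pi * s : ℂ) = 2 * (Real.pi * s / 2) by ring, Complex.cos_two_mul,
    show (2 * (Real.pi * s / 2) / 2 : ℂ) = Real.pi * s / 2 by ring, Complex.sin_sq]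
  ring

lemma differentiableAt_calA₀ (α μ : ℝ) {s : ℂ} (hs : s ≠ 1 ∨ ¬ IsInt μ) :
    DifferentiableAt ℂ (fun s => calA₀ s α μ) s := by
  have h1 := differentiableAt_lerchPsi α μ hs
  have h2 := differentiableAt_lerchPsi (-α) (-μ) (r := s) (by rwa [isInt_neg])
  unfold calA₀
  fun_prop

lemma tendsto_sub_one_mul_calA₀ (α μ : ℝ) :
    Tendsto (fun s => (s - 1) * calA₀ s α μ) (𝓝[≠] 1) (𝓝 0) := by
  obtain ⟨c, hc⟩ := tendsto_sub_one_mul_evenLerch α μ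
  have h1 : Tendsto (fun s : ℂ => cos (Real.pi * s / 2) ^ 2) (𝓝[≠] 1) (𝓝 0) := by
    have : Continuous fun s : ℂ => cos (Real.pi * s / 2) ^ 2 := by fun_prop
    simpa using (this.tendsto 1).mono_left nhdsWithin_le_nhds
  have h2 : Tendsto (fun s : ℂ => (s - 1) * (sin (Real.pi * s / 2) ^ 2 * oddLerch α μ s))
      (𝓝[≠] 1) (𝓝 0) := by
    have h := (differentiable_oddLerch α μ).continuous
    have : Continuous fun s : ℂ => (s - 1) * (sin (Real.pi * s / 2) ^ 2 * oddLerch α μ s) := by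
      fun_prop
    simpa using (this.tendsto 1).mono_left nhdsWithin_le_nhds
  have h3 := (h1.mul hc).add h2
  rw [zero_mul, zero_add] at h3
  refine h3.congr' ?_
  filter_upwards [self_mem_nhdsWithin] with s hs
  rw [calA₀_eq α μ hs]
  ring

lemma differentiable_calA (α μ : ℝ) : Differentiable ℂ fun s => calA s α μ := by
  have h := Complex.differentiableOn_update_limUnder_of_isLittleO (f := fun s => calA₀ s α μ)
    (s := univ) (c := 1) univ_mem
    (fun s hs => (differentiableAt_calA₀ α μ (.inl hs.2)).differentiableWithinAt) ?_
  · exact differentiableOn_univ.mp h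
  -- The removable singularity theorem bounds the difference from the value at the point; that value
  -- is irrelevant, as any constant is `o((z - 1)⁻¹)`.
  · have h0 : (fun _ : ℂ => calA₀ 1 α μ) =o[𝓝[≠] 1] fun z : ℂ => (z - 1)⁻¹ := by
      refine (isLittleO_const_left.mpr (.inr ?_))
      refine tendsto_norm_inv_nhdsNE_zero_atTop.comp
        (tendsto_nhdsWithin_iff.mpr ⟨?_, ?_⟩)
      · have : Continuous fun z : ℂ => z - 1 := by fun_prop
        simpa using (this.tendsto 1).mono_left nhdsWithin_le_nhds
      · filter_upwards [self_mem_nhdsWithin] with z hz using sub_ne_zero.mpr hz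
    refine IsLittleO.sub ?_ h0
    refine (isLittleO_iff_tendsto' ?_).mpr ?_
    · filter_upwards [self_mem_nhdsWithin] with s hs h
      exact absurd (inv_eq_zero.mp h) (sub_ne_zero.mpr hs)
    · refine (tendsto_sub_one_mul_calA₀ α μ).congr fun s => ?_
      rw [div_inv_eq_mul, mul_comm]

lemma calA_of_ne_one (α μ : ℝ) {s : ℂ} (hs : s ≠ 1) : calA s α μ = calA₀ s α μ := by
  rw [calA, Function.update_of_ne hs]

lemma calA_eq_calA₀ (α μ : ℝ) {s : ℂ} (hs : s ≠ 1 ∨ ¬ IsInt μ) : calA s α μ = calA₀ s α μ := by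
  rcases hs with hs | hs
  · exact calA_of_ne_one α μ hs
  · refine eq_of_eq_of_lt_re_of_differentiable (x := 1) (differentiable_calA α μ)
      (fun s => differentiableAt_calA₀ α μ (.inr hs)) (fun s h => calA_of_ne_one α μ ?_) s
    rintro rfl
    simp at h

lemma calA_eq_dual_of_one_lt (α μ : ℝ) {s : ℂ} (hs : 1 < s.re) :
    calA s α μ = e (α * μ) * ((2 * Real.pi : ℂ) ^ s * (2 * Gamma s)⁻¹) *
        (exp (-Real.pi * I * s / 2) * lerchPsi (1 - s) (-μ) α +
          exp (Real.pi * I * s / 2) * lerchPsi (1 - s) μ (-α)) := by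
  have hs0 : s ≠ 0 := fun h => by norm_num [h] at hs
  have hs1 : s ≠ 1 := fun h => by norm_num [h] at hs
  have hs2 : 1 - s ≠ 1 := by simpa using hs0
  have hG : Gamma s ≠ 0 := Gamma_ne_zero_of_re_pos (by linarith)
  have hpi : (2 * Real.pi : ℂ) ≠ 0 := by simp [Real.pi_ne_zero]
  have h2 : (2 * Real.pi : ℂ) ^ s * (2 * Gamma s)⁻¹ * Gammaℂ s = 1 := by
    rw [Gammaℂ_def, cpow_neg]
    have := (cpow_ne_zero_iff_of_exponent_ne_zero hs0).mpr hpi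
    field_simp
  have h3 := lerchPsi_neg_neg (-μ) α hs2
  rw [neg_neg] at h3
  have hE := evenLerch_one_sub α μ hs
  have hO := oddLerch_one_sub α μ hs
  have e1 : exp (-Real.pi * I * s / 2) = cos (Real.pi * s / 2) - sin (Real.pi * s / 2) * I := by
    rw [show (-Real.pi * I * s / 2 : ℂ) = (-(Real.pi * s / 2)) * I by ring, exp_mul_I, cos_neg,
      sin_neg]
    ring
  have e2 : exp (Real.pi * I * s / 2) = cos (Real.pi * s / 2) + sin (Real.pi * s / 2) * I := by
    rw [show (Real.pi * I * s / 2 : ℂ) = (Real.pi * s / 2) * I by ring, exp_mul_I]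
  -- With `C`, `S` the cosine and sine of `πs/2`, the bracket becomes `C` times the even minus `iS`
  -- times the odd function at `1 - s`. The functional equations supply a second factor `C`, resp.
  -- `S`, and `h2` cancels the Gamma factor.
  rw [calA_of_ne_one α μ hs1, calA₀_eq α μ hs1, lerchPsi_eq _ _ hs2, h3, lerchFun, e1, e2]
  set K := (2 * Real.pi : ℂ) ^ s * (2 * Gamma s)⁻¹
  set C := cos (Real.pi * s / 2 : ℂ)
  set S := sin (Real.pi * s / 2 : ℂ)
  linear_combination (-K * C) * hE + (-K * S) * hO -
    (C ^ 2 * evenLerch α μ s + S ^ 2 * oddLerch α μ s) * h2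

lemma calA_eq_dual (α μ : ℝ) {s : ℂ} (hs : s ≠ 0 ∨ ¬ IsInt α) :
    calA s α μ = e (α * μ) * ((2 * Real.pi : ℂ) ^ s * (2 * Gamma s)⁻¹) *
        (exp (-Real.pi * I * s / 2) * lerchPsi (1 - s) (-μ) α +
          exp (Real.pi * I * s / 2) * lerchPsi (1 - s) μ (-α)) := by
  have hd {s : ℂ} (hs : s ≠ 0 ∨ ¬ IsInt α) : DifferentiableAt ℂ (fun s : ℂ =>
      e (α * μ) * ((2 * Real.pi : ℂ) ^ s * (2 * Gamma s)⁻¹) *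
        (exp (-Real.pi * I * s / 2) * lerchPsi (1 - s) (-μ) α +
          exp (Real.pi * I * s / 2) * lerchPsi (1 - s) μ (-α))) s := by
    have h1 : DifferentiableAt ℂ (fun s : ℂ => lerchPsi (1 - s) (-μ) α) s :=
      (differentiableAt_lerchPsi (-μ) α (r := 1 - s) (by simpa using hs)).comp s
        (f := fun s : ℂ => 1 - s) (by fun_prop)
    have h2 : DifferentiableAt ℂ (fun s : ℂ => lerchPsi (1 - s) μ (-α)) s :=
      (differentiableAt_lerchPsi μ (-α) (r := 1 - s) (by simpa [isInt_neg] using hs)).comp s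
        (f := fun s : ℂ => 1 - s) (by fun_prop)
    have h3 : DifferentiableAt ℂ (fun s : ℂ => (2 * Gamma s)⁻¹) s := by
      simp_rw [mul_inv]
      exact (differentiable_one_div_Gamma s).const_mul _
    have h4 : DifferentiableAt ℂ (fun s : ℂ => (2 * Real.pi : ℂ) ^ s) s :=
      differentiableAt_id.const_cpow (.inl (by simp [Real.pi_ne_zero]))
    fun_prop
  rcases hs with hs | hs
  · exact eq_of_eq_of_lt_re (c := 0) (x := 1) (differentiable_calA α μ).differentiableOn
      (fun s hs => (hd (.inl hs)).differentiableWithinAt)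
      (fun s => calA_eq_dual_of_one_lt α μ) hs
  · exact eq_of_eq_of_lt_re_of_differentiable (x := 1) (differentiable_calA α μ)
      (fun s => hd (.inr hs)) (fun s => calA_eq_dual_of_one_lt α μ) s

/-! ### Lipschitz's formula -/

lemma hasDerivAt_integral_cpow_mul_exp {a r : ℂ} (ha : 0 < a.re) (hr : 0 < r.re) :
    HasDerivAt (fun r : ℂ => ∫ t : ℝ in Ioi 0, (t : ℂ) ^ (a - 1) * exp (-(r * t)))
      (∫ t : ℝ in Ioi 0, (t : ℂ) ^ (a - 1) * (exp (-(r * t)) * -t)) r := by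
  have hmeas (r : ℂ) : ContinuousOn (fun t : ℝ => (t : ℂ) ^ (a - 1) * exp (-(r * t))) (Ioi 0) := by
    refine ContinuousOn.mul (fun t ht => ?_) (by fun_prop)
    exact (continuousAt_ofReal_cpow_const _ _ (.inr (ne_of_gt ht))).continuousWithinAt
  have hmeas' : ContinuousOn (fun t : ℝ => (t : ℂ) ^ (a - 1) * (exp (-(r * t)) * -t)) (Ioi 0) := by
    refine ContinuousOn.mul (fun t ht => ?_) (by fun_prop)
    exact (continuousAt_ofReal_cpow_const _ _ (.inr (ne_of_gt ht))).continuousWithinAt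
  have hnorm (r : ℂ) {t : ℝ} (ht : 0 < t) : ‖(t : ℂ) ^ (a - 1) * exp (-(r * t))‖ =
      t ^ (a.re - 1) * Real.exp (-r.re * t) := by
    rw [norm_mul, norm_cpow_eq_rpow_re_of_pos ht, Complex.norm_exp]
    simp
  refine (hasDerivAt_integral_of_dominated_loc_of_deriv_le (μ := volume.restrict (Ioi 0))
    (F := fun (r : ℂ) (t : ℝ) => (t : ℂ) ^ (a - 1) * exp (-(r * t)))
    (F' := fun (r : ℂ) (t : ℝ) => (t : ℂ) ^ (a - 1) * (exp (-(r * t)) * -t))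
    -- On the ball of radius `r.re / 2` the real part stays above `r.re / 2`.
    (bound := fun t : ℝ => t ^ a.re * Real.exp (-(r.re / 2) * t ^ (1 : ℝ)))
    (s := Metric.ball r (r.re / 2)) (Metric.ball_mem_nhds r (by linarith))
    (.of_forall fun x => (hmeas x).aestronglyMeasurable measurableSet_Ioi) ?_
    (hmeas'.aestronglyMeasurable measurableSet_Ioi) ?_ ?_ ?_).2
  · have h := integrableOn_rpow_mul_exp_neg_mul_rpow (p := 1) (s := a.re - 1) (b := r.re)
      (by linarith) one_pos hr
    refine h.mono' ((hmeas r).aestronglyMeasurable measurableSet_Ioi) ?_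
    filter_upwards [ae_restrict_mem measurableSet_Ioi] with t ht
    rw [hnorm r ht, Real.rpow_one]
  · filter_upwards [ae_restrict_mem measurableSet_Ioi] with t ht x hx
    have ht' : (0 : ℝ) < t := ht
    rw [← mul_assoc, norm_mul, hnorm x ht, norm_neg, norm_real, Real.norm_of_nonneg ht'.le,
      mul_right_comm, ← Real.rpow_add_one ht'.ne', sub_add_cancel, Real.rpow_one]
    have hx' : r.re / 2 < x.re := by
      have h1 := (abs_re_le_norm (x - r)).trans_lt (mem_ball_iff_norm.mp hx)
      rw [sub_re, abs_lt] at h1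
      linarith
    gcongr
  · exact integrableOn_rpow_mul_exp_neg_mul_rpow (by linarith) one_pos (by linarith)
  · refine .of_forall fun t x _ => ?_
    have h : HasDerivAt (fun x : ℂ => -(x * t)) (-t) x := by
      simpa using! ((hasDerivAt_id x).mul_const (t : ℂ)).neg
    exact h.cexp.const_mul _

/-- Both sides are analytic in `r` on the right half-plane and agree at the reals `1 + 1 / (n + 1)`,
which accumulate at `1`. -/
lemma integral_cpow_mul_exp_neg_mul_Ioi_of_re_pos {a r : ℂ} (ha : 0 < a.re) (hr : 0 < r.re) :
    ∫ t : ℝ in Ioi 0, (t : ℂ) ^ (a - 1) * exp (-(r * t)) = (1 / r) ^ a * Gamma a := by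
  have hopen : IsOpen {r : ℂ | 0 < r.re} := isOpen_lt continuous_const continuous_re
  have hconn : IsPreconnected {r : ℂ | 0 < r.re} :=
    (convex_halfSpace_re_gt 0).isPreconnected
  have h1 : AnalyticOnNhd ℂ (fun r : ℂ => ∫ t : ℝ in Ioi 0, (t : ℂ) ^ (a - 1) * exp (-(r * t)))
      {r : ℂ | 0 < r.re} := DifferentiableOn.analyticOnNhd (fun r hr =>
    (hasDerivAt_integral_cpow_mul_exp ha hr).differentiableAt.differentiableWithinAt) hopen
  have h2 : AnalyticOnNhd ℂ (fun r : ℂ => (1 / r) ^ a * Gamma a) {r : ℂ | 0 < r.re} := by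
    refine DifferentiableOn.analyticOnNhd (fun r hr => ?_) hopen
    have hr' : (0 : ℝ) < r.re := hr
    have hr0 : r ≠ 0 := fun h => by simp [h] at hr'
    refine (DifferentiableAt.mul_const (DifferentiableAt.cpow_const
      (by fun_prop (disch := assumption)) ?_) _).differentiableWithinAt
    rw [one_div]
    refine .inl ?_
    rw [inv_re]
    exact div_pos hr' (normSq_pos.mpr hr0)
  refine h1.eqOn_of_preconnected_of_frequently_eq h2 hconn (z₀ := 1) (by simp) ?_ hr
  have hu : Tendsto (fun n : ℕ => (1 + 1 / ((n : ℂ) + 1))) atTop (𝓝[≠] 1) := by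
    refine tendsto_nhdsWithin_iff.mpr ⟨?_, .of_forall fun n => ?_⟩
    · simpa using (tendsto_one_div_add_atTop_nhds_zero_nat (𝕜 := ℂ)).const_add 1
    · simpa using Nat.cast_add_one_ne_zero (R := ℂ) n
  refine hu.frequently (Frequently.of_forall fun n => ?_)
  have := integral_cpow_mul_exp_neg_mul_Ioi (a := a) (r := 1 + 1 / ((n : ℝ) + 1)) ha (by positivity)
  push_cast at this
  exact this

/-- For `u` in the upper half-plane, `-2πiu` lies in the right half-plane. -/
lemma one_div_cpow_eq_powPlus {u : ℂ} (hu : 0 < u.im) (s : ℂ) :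
    (1 / (-(2 * Real.pi * I * u))) ^ s =
      exp (Real.pi * I * s / 2) / ((2 * Real.pi : ℂ) ^ s * powPlus u s) := by
  have hpi : (Real.pi : ℂ) ≠ 0 := ofReal_ne_zero.mpr Real.pi_ne_zero
  have hu0 : u ≠ 0 := fun h => by simp [h] at hu
  have harg0 : 0 ≤ arg u := arg_nonneg_iff.mpr hu.le
  have harg1 := arg_le_pi u
  -- The principal logarithm of `1 / (-2πiu)`: as `arg u` lies in `[0, π]`, the imaginary part `π/2
  -- - arg u` stays within `[-π/2, π/2]`.
  set L : ℂ := ((-(Real.log (2 * Real.pi) + Real.log ‖u‖) : ℝ) : ℂ) +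
    ((Real.pi / 2 - arg u : ℝ) : ℂ) * I with hL
  have hlog2 : exp (Real.log (2 * Real.pi) : ℂ) = 2 * Real.pi := by
    rw [← ofReal_exp, Real.exp_log (by positivity)]
    push_cast
    rfl
  have hlogu : exp (Real.log ‖u‖ + arg u * I) = u := by
    rw [Complex.exp_add, ← ofReal_exp, Real.exp_log (norm_pos_iff.mpr hu0), norm_mul_exp_arg_mul_I]
  have hexp : exp L = 1 / (-(2 * Real.pi * I * u)) := by
    have : L = -(Real.log (2 * Real.pi) : ℂ) - (Real.log ‖u‖ + arg u * I) + Real.pi / 2 * I := by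
      rw [hL]
      push_cast
      ring
    rw [this, Complex.exp_add, Complex.exp_sub, Complex.exp_neg, hlog2, hlogu,
      Complex.exp_pi_div_two_mul_I]
    field_simp
    rw [I_sq]
  have hlog : log (1 / (-(2 * Real.pi * I * u))) = L := by
    rw [← hexp, log_exp]
    · simp only [hL, add_im, ofReal_im, mul_im, ofReal_re, I_im, I_re]
      linarith [Real.pi_pos]
    · simp only [hL, add_im, ofReal_im, mul_im, ofReal_re, I_im, I_re]
      linarith [Real.pi_pos]
  have h2pi : log (2 * Real.pi : ℂ) = Real.log (2 * Real.pi) := by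
    rw [ofReal_log (by positivity)]
    push_cast
    rfl
  rw [cpow_def_of_ne_zero (hexp ▸ exp_ne_zero L), hlog, cpow_def_of_ne_zero (by simp), h2pi,
    powPlus, ← Complex.exp_add, ← Complex.exp_sub, hL]
  congr 1
  push_cast
  ring

lemma norm_inv_exp_mul_log_add_le {u s : ℂ} (hu : u ≠ 0) {x : ℝ} (hx : |x| ≤ Real.pi) :
    ‖(exp (s * (Real.log ‖u‖ + x * I)))⁻¹‖ ≤ ‖u‖ ^ (-s.re) * Real.exp (Real.pi * |s.im|) := by
  rw [norm_inv, Complex.norm_exp, ← Real.exp_neg,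
    Real.rpow_def_of_pos (norm_pos_iff.mpr hu), ← Real.exp_add]
  refine Real.exp_le_exp.mpr ?_
  have h1 : x * s.im ≤ Real.pi * |s.im| := by
    refine (le_abs_self _).trans ?_
    rw [abs_mul]
    gcongr
  simp
  linarith

lemma norm_inv_powPlus_le {u : ℂ} (s : ℂ) (hu : u ≠ 0) :
    ‖(powPlus u s)⁻¹‖ ≤ ‖u‖ ^ (-s.re) * Real.exp (Real.pi * |s.im|) :=
  norm_inv_exp_mul_log_add_le hu (abs_arg_le_pi u)

lemma norm_inv_powMinus_le {u : ℂ} (s : ℂ) (hu : u ≠ 0) :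
    ‖(powMinus u s)⁻¹‖ ≤ ‖u‖ ^ (-s.re) * Real.exp (Real.pi * |s.im|) := by
  refine norm_inv_exp_mul_log_add_le hu ?_
  rw [argMinus]
  split_ifs
  · rw [abs_neg, abs_of_pos Real.pi_pos]
  · exact abs_arg_le_pi u

lemma summable_inv_powPlus {w s : ℂ} (hw : w.im ≠ 0) (hs : 1 < s.re) :
    Summable fun m : ℤ => ‖(powPlus (m + w) s)⁻¹‖ := by
  have h := ((Real.summable_one_div_int_add_rpow w.re s.re).mpr hs).mul_right
    (Real.exp (Real.pi * |s.im|))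
  refine h.of_norm_bounded_eventually ?_
  -- The comparison `|m + w| ≥ |m + Re w|` can be raised to a negative power only if the smaller
  -- side is nonzero.
  have hfin : {m : ℤ | (m : ℝ) + w.re = 0}.Finite :=
    Set.Subsingleton.finite fun a ha b hb => by
      have : (a : ℝ) = b := by
        have := ha.trans (Eq.symm hb)
        simpa using this
      exact_mod_cast this
  filter_upwards [hfin.compl_mem_cofinite] with m hm
  have hm' : (m : ℝ) + w.re ≠ 0 := hm
  have hne : (m + w : ℂ) ≠ 0 := fun h0 => hw (by simpa using congrArg im h0)
  rw [norm_norm]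
  refine (norm_inv_powPlus_le s hne).trans ?_
  rw [one_div, ← Real.rpow_neg (abs_nonneg _)]
  gcongr ?_ * _
  refine Real.rpow_le_rpow_of_nonpos (abs_pos.mpr hm') ?_ (by linarith)
  simpa using abs_re_le_norm (m + w : ℂ)

/-- The function `y ^ (s - 1) e(y w)` on the positive reals, extended by zero. -/
def halfLineFun (s w : ℂ) (y : ℝ) : ℂ := ((max y 0 : ℝ) : ℂ) ^ (s - 1) * e (y * w)

lemma continuous_halfLineFun {s : ℂ} (w : ℂ) (hs : 1 < s.re) : Continuous (halfLineFun s w) := by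
  have h1 : Continuous fun x : ℝ => (x : ℂ) ^ (s - 1) :=
    continuous_ofReal_cpow_const (by simpa using hs)
  have h2 : Continuous fun y : ℝ => ((max y 0 : ℝ) : ℂ) ^ (s - 1) :=
    h1.comp (continuous_id.max continuous_const)
  unfold halfLineFun e
  fun_prop

lemma halfLineFun_of_nonpos {s : ℂ} (w : ℂ) (hs : 1 < s.re) {y : ℝ} (hy : y ≤ 0) :
    halfLineFun s w y = 0 := by
  have : s - 1 ≠ 0 := fun h => by rw [sub_eq_zero.mp h] at hs; simp at hs
  simp [halfLineFun, max_eq_right hy, this]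

lemma isBigO_halfLineFun {s w : ℂ} (hs : 1 < s.re) (hw : 0 < w.im) :
    halfLineFun s w =O[cocompact ℝ] fun x => |x| ^ (-2 : ℝ) := by
  rw [cocompact_eq_atBot_atTop, isBigO_sup]
  constructor
  · refine IsBigO.of_bound 1 ?_
    filter_upwards [eventually_le_atBot 0] with y hy
    rw [halfLineFun_of_nonpos w hs hy, norm_zero]
    positivity
  · have h := isLittleO_exp_neg_mul_rpow_atTop (a := 2 * Real.pi * w.im) (by positivity)
      (-2 - (s.re - 1))
    have h2 := (isBigO_refl (fun y : ℝ => y ^ (s.re - 1)) atTop).mul h.isBigO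
    refine (IsBigO.trans (Eventually.isBigO ?_) h2).trans (Eventually.isBigO ?_)
    · filter_upwards [eventually_gt_atTop 0] with y hy
      rw [halfLineFun, max_eq_left hy.le, norm_mul, norm_cpow_eq_rpow_re_of_pos hy, norm_e]
      simp
      ring_nf
      rfl
    · filter_upwards [eventually_gt_atTop 0] with y hy
      rw [← Real.rpow_add hy, abs_of_pos hy, Real.norm_of_nonneg (by positivity)]
      ring_nf
      rfl

open scoped FourierTransform in
lemma fourier_halfLineFun {s w : ℂ} (hs : 1 < s.re) (hw : 0 < w.im) (x : ℝ) :
    𝓕 (halfLineFun s w) x = Gamma s * (exp (Real.pi * I * s / 2) /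
      ((2 * Real.pi : ℂ) ^ s * powPlus (w - x) s)) := by
  rw [Real.fourier_real_eq_integral_exp_smul, ← one_div_cpow_eq_powPlus (by simpa using hw),
    mul_comm (Gamma s), ← integral_cpow_mul_exp_neg_mul_Ioi_of_re_pos (by linarith)
    (by simpa using by positivity)]
  rw [← setIntegral_eq_integral_of_forall_compl_eq_zero (s := Ioi 0)
    (fun y hy => by rw [halfLineFun_of_nonpos w hs (not_lt.mp hy), smul_zero])]
  refine setIntegral_congr_fun measurableSet_Ioi fun y hy => ?_
  have hy' : (0 : ℝ) ≤ y := le_of_lt (mem_Ioi.mp hy)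
  simp only [halfLineFun, max_eq_left hy', smul_eq_mul, e]
  rw [mul_left_comm, ← Complex.exp_add]
  congr 2
  push_cast
  ring

open scoped FourierTransform in
/-- **Lipschitz's formula.** -/
lemma hasSum_lipschitz (δ lam : ℝ) {s w : ℂ} (hs : 1 < s.re) (hw : 0 < w.im) :
    HasSum (fun m : ℤ => e (-((lam + m) * δ)) / powPlus (lam + m + w) s)
      (e (-(lam * δ)) * ((2 * Real.pi : ℂ) ^ s * (Gamma s)⁻¹) * exp (-Real.pi * I * s / 2) *
        ∑' l : {l : ℤ // -δ < l}, e ((δ + l) * lam) / ((δ + l : ℝ) : ℂ) ^ (1 - s) *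
          e ((δ + l) * w)) := by
  have hW : 0 < (lam + w : ℂ).im := by simpa using hw
  have hs0 : s ≠ 0 := fun h => by norm_num [h] at hs
  have hpi : (2 * Real.pi : ℂ) ≠ 0 := by simp [Real.pi_ne_zero]
  have hpow : (2 * Real.pi : ℂ) ^ s ≠ 0 := (cpow_ne_zero_iff_of_exponent_ne_zero hs0).mpr hpi
  have hG : Gamma s ≠ 0 := Gamma_ne_zero_of_re_pos (by linarith)
  -- The frequency is `-m` because the transform at `x` involves `w - x`.
  have hterm (m : ℤ) : 𝓕 (halfLineFun s (lam + w)) ((-m : ℤ) : ℝ) = Gamma s *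
      exp (Real.pi * I * s / 2) / (2 * Real.pi : ℂ) ^ s * (powPlus (m + (lam + w)) s)⁻¹ := by
    rw [fourier_halfLineFun hs hW, show (lam + w : ℂ) - ((-m : ℤ) : ℝ) = m + (lam + w) by
      push_cast; ring]
    field_simp
  have hsum0 : Summable fun n : ℤ => 𝓕 (halfLineFun s (lam + w)) (n : ℝ) := by
    rw [← (Equiv.neg ℤ).summable_iff]
    refine ((summable_inv_powPlus hW.ne' hs).of_norm.mul_left (Gamma s *
      exp (Real.pi * I * s / 2) / (2 * Real.pi : ℂ) ^ s)).congr fun m => ?_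
    rw [← hterm]
    rfl
  have hsum : Summable fun n : ℤ => 𝓕 (halfLineFun s (lam + w)) (n : ℝ) *
      fourier n (δ : UnitAddCircle) := by
    refine Summable.of_norm (hsum0.norm.congr fun n => ?_)
    rw [norm_mul, fourier_apply, Circle.norm_coe, mul_one]
  -- Poisson summation over `δ + ℤ`; the shift appears as a character on the frequency side.
  have hP := Real.tsum_eq_tsum_fourier_of_rpow_decay_of_summable
    (continuous_halfLineFun (lam + w) hs) one_lt_two (isBigO_halfLineFun hs hW) hsum0 δ
  have hleft : ∑' n : ℤ, halfLineFun s (lam + w) (δ + n) =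
      ∑' l : {l : ℤ // -δ < l}, e ((δ + l) * lam) / ((δ + l : ℝ) : ℂ) ^ (1 - s) *
          e ((δ + l) * w) := by
    refine Eq.trans (tsum_congr fun l => ?_) (tsum_subtype {l : ℤ | -δ < l} (fun l : ℤ =>
      e ((δ + l) * lam) / ((δ + l : ℝ) : ℂ) ^ (1 - s) * e ((δ + l) * w))).symm
    by_cases hl : -δ < l
    · rw [indicator_of_mem (show l ∈ {l : ℤ | -δ < l} from hl), halfLineFun,
        max_eq_left (by linarith), ← neg_sub s 1, cpow_neg, div_inv_eq_mul, mul_add, e_add]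
      push_cast
      ring
    · rw [indicator_of_notMem (show l ∉ {l : ℤ | -δ < l} from hl),
        halfLineFun_of_nonpos _ hs (by linarith)]
  rw [← hleft, hP]
  have h := ((Equiv.neg ℤ).hasSum_iff.mpr hsum.hasSum).mul_left (e (-(lam * δ)) *
    ((2 * Real.pi : ℂ) ^ s * (Gamma s)⁻¹) * exp (-Real.pi * I * s / 2))
  refine h.congr_fun fun m => ?_
  have hexp : exp (-Real.pi * I * s / 2) = (exp (Real.pi * I * s / 2))⁻¹ := by
    rw [← Complex.exp_neg]
    congr 1
    ring
  have hfour : fourier (-m) (δ : UnitAddCircle) = e (-(m * δ)) := by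
    rw [fourier_coe_apply, e]
    congr 1
    push_cast
    ring
  simp only [Function.comp_apply, Equiv.neg_apply]
  rw [hterm, hexp, hfour, show -((lam + m) * δ : ℂ) = -(lam * δ) + -(m * δ) by ring, e_add,
    show (lam + m + w : ℂ) = m + (lam + w) by ring]
  have := exp_ne_zero (Real.pi * I * s / 2)
  field_simp

/-! ### The `q`-series -/

lemma fracPrime_eq (γ : ℝ) : fracPrime γ = γ + ⌊-γ⌋ + 1 := by
  rw [fracPrime, Int.fract]
  ring

lemma fracPrime_pos (γ : ℝ) : 0 < fracPrime γ := by
  rw [fracPrime_eq]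
  linarith [Int.lt_floor_add_one (-γ)]

/-- The integers `k > -γ` are enumerated by `ℕ`. -/
def natEquivGt (γ : ℝ) : ℕ ≃ {k : ℤ // -γ < k} where
  toFun j := ⟨⌊-γ⌋ + 1 + j, Int.floor_lt.mp (by lia)⟩
  invFun k := (k - ⌊-γ⌋ - 1).toNat
  left_inv j := by
    simp only
    lia
  right_inv k := by
    have := Int.floor_lt.mpr k.2
    ext
    simp only
    lia

lemma coe_natEquivGt (γ : ℝ) (j : ℕ) : ((natEquivGt γ j : ℤ) : ℝ) = fracPrime γ + j - γ := by
  rw [fracPrime_eq]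
  simp only [natEquivGt, Equiv.coe_fn_mk]
  push_cast
  ring

lemma add_natEquivGt (γ : ℝ) (j : ℕ) : γ + (natEquivGt γ j : ℤ) = fracPrime γ + j := by
  rw [coe_natEquivGt]
  ring

lemma add_natEquivGt_complex (γ : ℝ) (j : ℕ) :
    (γ : ℂ) + ((natEquivGt γ j : ℤ) : ℂ) = fracPrime γ + j := by
  exact_mod_cast congrArg ((↑) : ℝ → ℂ) (add_natEquivGt γ j)

lemma norm_qTerm (r : ℂ) (γ δ κ lam : ℝ) (z : ℂ) (k : ℤ) {l : ℤ} (hl : -δ < l) :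
    ‖qTerm r γ δ κ lam z k l‖ =
      (δ + l) ^ (-r.re) * Real.exp (-(2 * Real.pi * z.im * ((γ + k) * (δ + l)))) := by
  have hl' : 0 < δ + l := by linarith
  rw [qTerm, norm_mul, norm_div, norm_cpow_eq_rpow_re_of_pos hl',
    show ((γ + k) * κ + (δ + l) * lam : ℂ) = (((γ + k) * κ + (δ + l) * lam : ℝ) : ℂ) by
      push_cast; rfl, norm_e_ofReal, norm_e,
    show ((γ + k) * (δ + l) * z : ℂ) = (((γ + k) * (δ + l) : ℝ) : ℂ) * z by push_cast; rfl,
    im_ofReal_mul, Real.rpow_neg hl'.le]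
  ring_nf

/-- Half of the exponential absorbs the power, and the other half is geometric. -/
lemma summable_rpow_mul_exp_neg {d b : ℝ} (hb : 0 < b) (p : ℝ) :
    Summable fun j : ℕ => (d + j) ^ p * Real.exp (-(b * (d + j))) := by
  have h1 := (isLittleO_rpow_exp_pos_mul_atTop p (b := b / 2) (by positivity)).isBigO
  have h2 : Tendsto (fun j : ℕ => d + (j : ℝ)) atTop atTop :=
    tendsto_atTop_add_const_left _ _ tendsto_natCast_atTop_atTop
  have h3 := (h1.comp_tendsto h2).mul
    (isBigO_refl (fun j : ℕ => Real.exp (-(b * (d + j)))) atTop)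
  refine summable_of_isBigO_nat ?_ h3
  have h4 : Summable fun j : ℕ => Real.exp (-(b / 2 * d)) * Real.exp (-(b / 2)) ^ j :=
    (summable_geometric_of_lt_one (Real.exp_pos _).le
      (Real.exp_lt_one_iff.mpr (by linarith))).mul_left _
  refine h4.congr fun j => ?_
  rw [← Real.exp_nat_mul, Function.comp_apply, ← Real.exp_add, ← Real.exp_add]
  congr 1
  ring

lemma summable_norm_qTerm (r : ℂ) (γ δ κ lam : ℝ) {z : ℂ} (hz : 0 < z.im) :
    Summable fun p : QIndex γ δ => ‖qTerm r γ δ κ lam z p.1 p.2‖ := by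
  rw [← ((natEquivGt γ).prodCongr (natEquivGt δ)).summable_iff]
  have hc := fracPrime_pos γ
  have hd := fracPrime_pos δ
  have hy : 0 < 2 * Real.pi * z.im := by positivity
  have h1 : Summable fun i : ℕ => Real.exp (-(2 * Real.pi * z.im * fracPrime δ)) ^ i :=
    summable_geometric_of_lt_one (Real.exp_pos _).le
      (Real.exp_lt_one_iff.mpr (by linarith [mul_pos hy hd]))
  have h2 := summable_rpow_mul_exp_neg (d := fracPrime δ) (mul_pos hy hc) (-r.re)
  refine (h1.mul_of_nonneg h2 (fun i => by positivity) fun j => by positivity).of_nonneg_of_le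
    (fun _ => norm_nonneg _) fun ⟨i, j⟩ => ?_
  simp only [Function.comp_apply, Equiv.prodCongr_apply, Prod.map_apply]
  rw [norm_qTerm _ _ _ _ _ _ _ (natEquivGt δ j).2, add_natEquivGt, add_natEquivGt,
    mul_left_comm (Real.exp _ ^ i), ← Real.exp_nat_mul, ← Real.exp_add]
  gcongr
  -- With `c = ⟨γ⟩'` and `d = ⟨δ⟩'`, dropping `ij` from `(c + i)(d + j)` leaves `id + c(d + j)`,
  -- which separates the variables.
  have : 0 ≤ 2 * Real.pi * z.im * (i * j) := by positivity
  nlinarith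

lemma rpow_le_rpow_add_rpow {x p q R : ℝ} (hx : 0 < x) (hp : q ≤ p) (hp' : p ≤ R) :
    x ^ p ≤ x ^ R + x ^ q := by
  rcases le_total 1 x with h | h
  · exact (Real.rpow_le_rpow_of_exponent_le h hp').trans (le_add_of_nonneg_right (by positivity))
  · exact (Real.rpow_le_rpow_of_exponent_ge hx h hp).trans
      (le_add_of_nonneg_left (by positivity))

lemma differentiable_qSeries_one_sub (γ δ κ lam : ℝ) {z : ℂ} (hz : 0 < z.im) :
    Differentiable ℂ fun s => qSeries (1 - s) γ δ κ lam z := by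
  intro s
  obtain ⟨R, hR⟩ := exists_gt ‖s‖
  have hU : IsOpen (Metric.ball (0 : ℂ) R) := Metric.isOpen_ball
  refine DifferentiableOn.differentiableAt (s := Metric.ball (0 : ℂ) R) ?_
    (hU.mem_nhds (by simpa using hR))
  -- For `|s| < R` the exponent of `δ + l` lies between `-1 - R` and `R - 1`, so the two extreme
  -- series together majorise.
  have hu := (summable_norm_qTerm ((1 - R : ℝ) : ℂ) γ δ κ lam hz).add
    (summable_norm_qTerm ((1 + R : ℝ) : ℂ) γ δ κ lam hz)
  refine differentiableOn_tsum_of_summable_norm hu (fun p => ?_) hU fun p w hw => ?_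
  · have hl : (0 : ℝ) < δ + (p.2 : ℤ) := by linarith [p.2.2]
    have hl0 : ((δ + (p.2 : ℤ) : ℝ) : ℂ) ≠ 0 := ofReal_ne_zero.mpr hl.ne'
    have h1 : Differentiable ℂ fun s : ℂ => ((δ + (p.2 : ℤ) : ℝ) : ℂ) ^ (1 - s) :=
      (differentiable_id.const_sub 1).const_cpow (.inl hl0)
    refine Differentiable.differentiableOn ?_
    unfold qTerm
    exact (Differentiable.div (differentiable_const _) h1
      fun s h => hl0 ((cpow_eq_zero_iff _ _).mp h).1).mul_const _
  · have hl : (0 : ℝ) < δ + (p.2 : ℤ) := by linarith [p.2.2]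
    have hw' : |w.re| < R := (abs_re_le_norm w).trans_lt (by simpa using hw)
    rw [abs_lt] at hw'
    rw [norm_qTerm _ _ _ _ _ _ _ p.2.2, norm_qTerm _ _ _ _ _ _ _ p.2.2,
      norm_qTerm _ _ _ _ _ _ _ p.2.2, ← add_mul]
    gcongr
    refine rpow_le_rpow_add_rpow hl ?_ ?_ <;> simp <;> linarith

lemma norm_e_mul_e (κ x : ℝ) (z : ℂ) :
    ‖e κ * e (x * z)‖ = Real.exp (-(2 * Real.pi * x * z.im)) := by
  rw [norm_mul, norm_e_ofReal, norm_e, im_ofReal_mul, one_mul]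
  ring_nf

lemma hasSum_qTerm_fst (r : ℂ) (γ δ κ lam : ℝ) {z : ℂ} (hz : 0 < z.im) {l : ℤ} (hl : -δ < l) :
    HasSum (fun k : {k : ℤ // -γ < k} => qTerm r γ δ κ lam z k l)
      (qTermSum r γ δ κ lam z l) := by
  rw [← (natEquivGt γ).hasSum_iff]
  have hl' : 0 < δ + l := by linarith
  have hx : ‖e κ * e ((δ + l) * z)‖ < 1 := by
    have := norm_e_mul_e κ (δ + l) z
    push_cast at this
    rw [this, Real.exp_lt_one_iff]
    have : 0 < 2 * Real.pi * (δ + l) * z.im := by positivity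
    linarith
  have h := (hasSum_geometric_of_norm_lt_one hx).mul_left (e (fracPrime γ * κ) *
    (e ((δ + l) * lam) * e (fracPrime γ * (δ + l) * z)) / ((δ + l : ℝ) : ℂ) ^ r)
  rw [qTermSum, ← div_div, div_eq_mul_inv _ (1 - _)]
  refine h.congr_fun fun j => ?_
  have hpow (x : ℂ) : e x ^ j = e (j * x) := by
    rw [e, e, ← Complex.exp_nat_mul]
    ring_nf
  rw [Function.comp_apply, qTerm, add_natEquivGt_complex, mul_pow, hpow, hpow,
    show (fracPrime γ + j : ℂ) * κ + (δ + l) * lam = fracPrime γ * κ + j * κ + (δ + l) * lam by ring,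
    show (fracPrime γ + j : ℂ) * (δ + l) * z =
      fracPrime γ * (δ + l) * z + j * ((δ + l) * z) by ring]
  simp only [e_add]
  ring

lemma hasSum_qTerm_swap (r : ℂ) (γ δ κ lam : ℝ) {z : ℂ} (hz : 0 < z.im) :
    HasSum (fun p : {l : ℤ // -δ < l} × {k : ℤ // -γ < k} =>
      qTerm r γ δ κ lam z p.2 p.1) (qSeries r γ δ κ lam z) := by
  rw [← (Equiv.prodComm {k : ℤ // -γ < k} {l : ℤ // -δ < l}).hasSum_iff]
  exact (summable_norm_qTerm r γ δ κ lam hz).of_norm.hasSum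

lemma hasSum_qTermSum (r : ℂ) (γ δ κ lam : ℝ) {z : ℂ} (hz : 0 < z.im) :
    HasSum (fun l : {l : ℤ // -δ < l} => qTermSum r γ δ κ lam z l) (qSeries r γ δ κ lam z) := by
  have h1 := hasSum_qTerm_swap r γ δ κ lam hz
  have h2 (l : {l : ℤ // -δ < l}) : HasSum (fun k : {k : ℤ // -γ < k} => qTerm r γ δ κ lam z k l)
      (qTermSum r γ δ κ lam z l) := hasSum_qTerm_fst r γ δ κ lam hz l.2
  generalize qSeries r γ δ κ lam z = A at *
  generalize qTerm r γ δ κ lam z = B at *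
  generalize qTermSum r γ δ κ lam z = C at *
  exact h1.prod_fiberwise h2

/-! ### Asymptotics in sectors. -/

lemma tendsto_re_atInftySector {θ : ℝ} (hθ : θ < Real.pi / 2) :
    Tendsto re (atInftySector θ) atTop := by
  have hcob : Tendsto (fun τ : ℂ => ‖τ‖ * Real.cos θ) (atInftySector θ) atTop ∨
      atInftySector θ = ⊥ := by
    -- For negative `θ` the sector is empty and the filter trivial.
    rcases lt_or_ge θ 0 with h | h
    · right
      have : {τ : ℂ | |arg τ| ≤ θ} = ∅ := by
        ext τ
        simpa using h.trans_le (abs_nonneg _)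
      rw [atInftySector, this]
      simp
    · left
      refine Tendsto.atTop_mul_const (Real.cos_pos_of_mem_Ioo ⟨by linarith [Real.pi_pos], hθ⟩) ?_
      exact tendsto_norm_cobounded_atTop.mono_left inf_le_left
  rcases hcob with h | h
  · refine tendsto_atTop_mono' _ ?_ h
    have hmem : {τ : ℂ | |arg τ| ≤ θ} ∈ atInftySector θ :=
      mem_inf_of_right (mem_principal_self _)
    filter_upwards [hmem] with τ hτ
    rw [← norm_mul_cos_arg τ]
    have hτ' : |arg τ| ≤ θ := hτ
    rw [← Real.cos_abs (arg τ)]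
    gcongr ‖τ‖ * ?_
    exact Real.cos_le_cos_of_nonneg_of_le_pi (abs_nonneg _) (by linarith [Real.pi_pos]) hτ'
  · rw [h]
    exact tendsto_bot

lemma e_mul_I_mul (x τ : ℂ) : e (x * (I * τ)) = exp (-2 * Real.pi * x * τ) := by
  rw [e]
  congr 1
  linear_combination (2 * Real.pi * x * τ) * I_mul_I

lemma tendsto_e_mul_e_atInftySector (κ : ℝ) {x θ : ℝ} (hx : 0 < x) (hθ : θ < Real.pi / 2) :
    Tendsto (fun τ : ℂ => e κ * e (x * (I * τ))) (atInftySector θ) (𝓝 0) := by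
  rw [tendsto_zero_iff_norm_tendsto_zero]
  have h : Tendsto (fun τ : ℂ => 2 * Real.pi * x * τ.re) (atInftySector θ) atTop :=
    (tendsto_re_atInftySector hθ).const_mul_atTop (by positivity)
  refine (Real.tendsto_exp_neg_atTop_nhds_zero.comp h).congr fun τ => ?_
  rw [norm_e_mul_e, Function.comp_apply, I_mul_im]

lemma qTermSum_isTheta (r : ℂ) (γ δ κ lam : ℝ) {θ : ℝ} (hθ : θ < Real.pi / 2) {l : ℤ}
    (hl : -δ < l) : (fun τ : ℂ => qTermSum r γ δ κ lam (I * τ) l) =Θ[atInftySector θ]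
      fun τ : ℂ => exp (-2 * Real.pi * fracPrime γ * (δ + l) * τ) := by
  have hl' : 0 < δ + l := by linarith
  have h1 : Tendsto (fun τ : ℂ => (1 - e κ * e ((δ + l) * (I * τ)))⁻¹) (atInftySector θ)
      (𝓝 1) := by
    have := (tendsto_e_mul_e_atInftySector κ hl' hθ).const_sub 1
    simpa using this.inv₀ (by simp)
  have h2 : (fun τ : ℂ => (1 - e κ * e ((δ + l) * (I * τ)))⁻¹) =Θ[atInftySector θ]
      fun _ => (1 : ℂ) :=
    ((isEquivalent_const_iff_tendsto one_ne_zero).mpr h1).isTheta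
  set c : ℂ := e (fracPrime γ * κ) * e ((δ + l) * lam) / ((δ + l : ℝ) : ℂ) ^ r
  have hc : c ≠ 0 := by
    have : ((δ + l : ℝ) : ℂ) ≠ 0 := ofReal_ne_zero.mpr hl'.ne'
    exact div_ne_zero (mul_ne_zero (e_ne_zero _) (e_ne_zero _))
      fun h => this ((cpow_eq_zero_iff _ _).mp h).1
  have h3 := ((isTheta_refl (fun τ : ℂ => exp (-2 * Real.pi * fracPrime γ * (δ + l) * τ))
    (atInftySector θ)).mul h2).const_mul_left hc
  simp only [mul_one] at h3
  refine IsTheta.trans (EventuallyEq.isTheta (.of_forall fun τ => ?_)) h3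
  simp only [qTermSum, c]
  rw [e_mul_I_mul (fracPrime γ * (δ + l)), ← div_div, div_eq_mul_inv _ (1 - _),
    show -2 * Real.pi * fracPrime γ * (δ + l) * τ =
      (-2 * Real.pi * (fracPrime γ * (δ + l)) * τ : ℂ) by ring]
  ring

lemma sum_Ioc_eq_sum_range (f : ℤ → ℂ) (a : ℤ) (n : ℕ) :
    ∑ l ∈ Finset.Ioc a (a + n), f l = ∑ j ∈ Finset.range n, f (a + 1 + j) := by
  refine (Finset.sum_bij (fun (j : ℕ) _ => a + 1 + (j : ℤ)) ?_ ?_ ?_ ?_).symm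
  · intro j hj
    simp only [Finset.mem_range, Finset.mem_Ioc] at *
    lia
  · intro i _ j _ h
    lia
  · intro l hl
    simp only [Finset.mem_range, Finset.mem_Ioc] at *
    exact ⟨(l - a - 1).toNat, by lia, by lia⟩
  · intro j _
    rfl

lemma hasSum_qSeries_sub_qPartialSum (r : ℂ) (γ δ κ lam : ℝ) {z : ℂ} (hz : 0 < z.im) {L : ℤ}
    (hL : ⌊-δ⌋ ≤ L) : HasSum (fun j : ℕ => qTermSum r γ δ κ lam z (L + 1 + j))
      (qSeries r γ δ κ lam z - qPartialSum r γ δ κ lam z L) := by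
  have h := (natEquivGt δ).hasSum_iff.mpr (hasSum_qTermSum r γ δ κ lam hz)
  obtain ⟨n, rfl⟩ := Int.le.dest hL
  rw [qPartialSum, sum_Ioc_eq_sum_range]
  refine ((hasSum_nat_add_iff' n).mpr h).congr_fun fun j => ?_
  simp only [Function.comp_apply, natEquivGt, Equiv.coe_fn_mk]
  congr 1
  push_cast
  ring

lemma qSeries_sub_qPartialSum_isBigO (r : ℂ) (γ δ κ lam : ℝ) {θ : ℝ} (hθ : θ < Real.pi / 2)
    {L : ℤ} (hL : ⌊-δ⌋ ≤ L) :
    (fun τ : ℂ => qSeries r γ δ κ lam (I * τ) - qPartialSum r γ δ κ lam (I * τ) L)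
      =O[atInftySector θ]
      fun τ : ℂ => exp (-2 * Real.pi * fracPrime γ * (δ + (L + 1)) * τ) := by
  have hc := fracPrime_pos γ
  have hD : 0 < δ + (L + 1) := by
    have : (⌊-δ⌋ : ℝ) ≤ L := by exact_mod_cast hL
    linarith [Int.lt_floor_add_one (-δ)]
  have hsum := (summable_rpow_mul_exp_neg (d := δ + (L + 1)) (b := 2 * Real.pi * fracPrime γ)
    (by positivity) (-r.re)).mul_left (2 * Real.exp (2 * Real.pi * fracPrime γ * (δ + (L + 1))))
  -- The constant is the tail's majorant at `τ = 1`, divided by the exponential factor of its first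
  -- term: for `Re τ ≥ 1` the relative decay of later terms is at least that at `1`. The factor 2
  -- bounds the inverse denominators, which are at least `1/2` in modulus once `hsmall` applies.
  refine IsBigO.of_bound (∑' j : ℕ, 2 * Real.exp (2 * Real.pi * fracPrime γ * (δ + (L + 1))) *
    ((δ + (L + 1) + j) ^ (-r.re) *
      Real.exp (-(2 * Real.pi * fracPrime γ * (δ + (L + 1) + j))))) ?_
  have hsmall := (tendsto_e_mul_e_atInftySector κ hD hθ).norm.eventually_le_const
    (show ‖(0 : ℂ)‖ < 1 / 2 by norm_num)
  filter_upwards [(tendsto_re_atInftySector hθ).eventually_ge_atTop 1, hsmall] with τ hτ hτ'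
  have hz : 0 < (I * τ).im := by
    rw [I_mul_im]
    linarith
  rw [← (hasSum_qSeries_sub_qPartialSum r γ δ κ lam hz hL).tsum_eq]
  refine tsum_of_norm_bounded (hsum.hasSum.mul_right _) fun j => ?_
  have hj : (0 : ℝ) ≤ j := Nat.cast_nonneg j
  have hDj : 0 < δ + ((L + 1 + j : ℤ) : ℝ) := by push_cast; linarith
  have hx : ‖e κ * e ((δ + (L + 1 + j : ℤ)) * (I * τ))‖ ≤ 1 / 2 := by
    refine le_trans ?_ hτ'
    have := norm_e_mul_e κ (δ + (L + 1 + j : ℤ)) (I * τ)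
    rw [norm_e_mul_e]
    push_cast at this ⊢
    rw [this, I_mul_im, Real.exp_le_exp]
    have : 0 ≤ 2 * Real.pi * j * τ.re := by positivity
    linarith
  have hx' : (1 / 2 : ℝ) ≤ ‖1 - e κ * e ((δ + (L + 1 + j : ℤ)) * (I * τ))‖ := by
    have := norm_sub_norm_le (1 : ℂ) (e κ * e ((δ + (L + 1 + j : ℤ)) * (I * τ)))
    rw [norm_one] at this
    linarith
  have hexp : ‖exp (-2 * Real.pi * fracPrime γ * (δ + (L + 1)) * τ)‖ =
      Real.exp (-(2 * Real.pi * fracPrime γ * (δ + (L + 1)) * τ.re)) := by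
    rw [Complex.norm_exp, show (-2 * Real.pi * fracPrime γ * (δ + (L + 1)) * τ : ℂ) =
      ((-(2 * Real.pi * fracPrime γ * (δ + (L + 1))) : ℝ) : ℂ) * τ by push_cast; ring,
      re_ofReal_mul]
    ring_nf
  have hnum : ‖e (fracPrime γ * (δ + (L + 1 + j : ℤ)) * (I * τ))‖ =
      Real.exp (-(2 * Real.pi * fracPrime γ * (δ + (L + 1) + j) * τ.re)) := by
    rw [norm_e, show (fracPrime γ * (δ + (L + 1 + j : ℤ)) * (I * τ) : ℂ) =
      ((fracPrime γ * (δ + (L + 1) + j) : ℝ) : ℂ) * (I * τ) by push_cast; ring, im_ofReal_mul,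
      I_mul_im]
    ring_nf
  have hlam : ‖e ((δ + (L + 1 + j : ℤ)) * lam)‖ = 1 := by
    exact_mod_cast norm_e_ofReal ((δ + (L + 1 + j : ℤ)) * lam)
  have hkap : ‖e (fracPrime γ * κ)‖ = 1 := by
    exact_mod_cast norm_e_ofReal (fracPrime γ * κ)
  rw [qTermSum, norm_div, norm_mul, norm_mul, norm_mul, norm_cpow_eq_rpow_re_of_pos hDj, hexp,
    hnum, hlam, hkap, one_mul, one_mul, div_eq_mul_inv, mul_inv, ← Real.rpow_neg hDj.le]
  have hinv : ‖1 - e κ * e ((δ + (L + 1 + j : ℤ)) * (I * τ))‖⁻¹ ≤ 2 := by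
    rw [inv_le_comm₀ (by linarith) two_pos]
    simpa using hx'
  have hE : Real.exp (-(2 * Real.pi * fracPrime γ * (δ + (L + 1) + j) * τ.re)) ≤
      Real.exp (2 * Real.pi * fracPrime γ * (δ + (L + 1))) *
        Real.exp (-(2 * Real.pi * fracPrime γ * (δ + (L + 1) + j))) *
        Real.exp (-(2 * Real.pi * fracPrime γ * (δ + (L + 1)) * τ.re)) := by
    rw [← Real.exp_add, ← Real.exp_add, Real.exp_le_exp]
    have : 0 ≤ 2 * Real.pi * fracPrime γ * j * (τ.re - 1) := by
      have := sub_nonneg.mpr hτ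
      positivity
    nlinarith
  have hDj' : δ + ((L + 1 + j : ℤ) : ℝ) = δ + (L + 1) + j := by push_cast; ring
  rw [hDj']
  rw [hDj'] at hDj
  calc _ ≤ (Real.exp (2 * Real.pi * fracPrime γ * (δ + (L + 1))) *
        Real.exp (-(2 * Real.pi * fracPrime γ * (δ + (L + 1) + j))) *
        Real.exp (-(2 * Real.pi * fracPrime γ * (δ + (L + 1)) * τ.re))) *
        ((δ + (L + 1) + j) ^ (-r.re) * 2) := by gcongr
    _ = _ := by ring

lemma isAsymptoticQSeries (r : ℂ) (γ δ κ lam : ℝ) : IsAsymptoticQSeries r γ δ κ lam where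
  hasSum _ hz := hasSum_qTermSum r γ δ κ lam hz
  order _ hθ _ hl := qTermSum_isTheta r γ δ κ lam hθ hl
  remainder _ hθ _ hL := qSeries_sub_qPartialSum_isBigO r γ δ κ lam hθ hL

/-! ### The Eisenstein series -/

/-- For all but finitely many indices the shift `α + βz` uses up at most half of the lower bound
`r‖x‖` known for the unshifted lattice. -/
lemma summable_norm_latticePt_rpow (α β : ℝ) {z : ℂ} (hz : 0 < z.im) {σ : ℝ} (hσ : 2 < σ) :
    Summable fun p : ℤ × ℤ => ‖latticePt α β z p‖ ^ (-σ) := by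
  rw [← ((finTwoArrowEquiv ℤ).trans (Equiv.prodComm ℤ ℤ)).summable_iff]
  set r := EisensteinSeries.r ⟨z, hz⟩ with hr
  have hr0 : 0 < r := EisensteinSeries.r_pos _
  refine ((EisensteinSeries.summable_one_div_norm_rpow hσ).mul_left
    ((r / 2) ^ (-σ))).of_norm_bounded_eventually ?_
  have hnorm : Tendsto (fun x : Fin 2 → ℤ => ‖x‖) cofinite atTop := by
    simpa [Function.comp_def] using tendsto_norm_comp_cofinite_atTop_of_isClosedEmbedding
      (Topology.IsClosedEmbedding.id (X := Fin 2 → ℤ))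
  filter_upwards [hnorm.eventually_gt_atTop 0,
    hnorm.eventually_ge_atTop (‖(α + β * z : ℂ)‖ / (r / 2))] with x hx0 hx1
  have hx : x ≠ 0 := norm_pos_iff.mp hx0
  have h1 : r * ‖x‖ ≤ ‖(x 0 * z + x 1 : ℂ)‖ := EisensteinSeries.r_mul_max_le ⟨z, hz⟩ hx
  have h2 : ‖(α + β * z : ℂ)‖ ≤ r / 2 * ‖x‖ := by
    rwa [div_le_iff₀ (by positivity), mul_comm ‖x‖] at hx1
  have h3 : r / 2 * ‖x‖ ≤ ‖latticePt α β z (x 1, x 0)‖ := by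
    have h4 := norm_sub_norm_le (x 0 * z + x 1 : ℂ) (-(α + β * z))
    rw [norm_neg] at h4
    have h5 : latticePt α β z (x 1, x 0) = x 0 * z + x 1 - -(α + β * z) := by
      simp only [latticePt]
      ring
    rw [h5]
    linarith
  change ‖‖latticePt α β z (x 1, x 0)‖ ^ (-σ)‖ ≤ _
  rw [Real.norm_of_nonneg (Real.rpow_nonneg (norm_nonneg _) _), ← Real.mul_rpow (by positivity) (by positivity)]
  exact Real.rpow_le_rpow_of_nonpos (by positivity) h3 (by linarith)

lemma norm_eisTerm (pow : ℂ → ℂ → ℂ) (s : ℂ) (α β μ ν : ℝ) (z : ℂ) (p : ℤ × ℤ) :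
    ‖eisTerm pow s α β μ ν z p‖ = ‖(pow (latticePt α β z p) s)⁻¹‖ := by
  have : ‖e ((α + p.1) * μ + (β + p.2) * ν)‖ = 1 := by
    exact_mod_cast norm_e_ofReal ((α + p.1) * μ + (β + p.2) * ν)
  rw [eisTerm, norm_div, norm_inv, this, one_div]

lemma summable_norm_eisTerm {pow : ℂ → ℂ → ℂ} {s : ℂ} (hpow : ∀ u ≠ 0,
      ‖(pow u s)⁻¹‖ ≤ ‖u‖ ^ (-s.re) * Real.exp (Real.pi * |s.im|)) (α β μ ν : ℝ) {z : ℂ}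
    (hs : 2 < s.re) (hz : 0 < z.im) :
    Summable fun p : {p : ℤ × ℤ // latticePt α β z p ≠ 0} => ‖eisTerm pow s α β μ ν z p‖ := by
  refine (((summable_norm_latticePt_rpow α β hz hs).mul_right
    (Real.exp (Real.pi * |s.im|))).comp_injective Subtype.val_injective).of_nonneg_of_le
    (fun _ => norm_nonneg _) fun p => ?_
  rw [norm_eisTerm]
  exact hpow _ p.2

/-- The mean of the summands for the two branches, extended by zero. -/
def meanTerm (s : ℂ) (α β μ ν : ℝ) (z : ℂ) : ℤ × ℤ → ℂ :=
  {p : ℤ × ℤ | latticePt α β z p ≠ 0}.indicator fun p =>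
    (eisTerm powPlus s α β μ ν z p + eisTerm powMinus s α β μ ν z p) / 2

lemma hasSum_meanTerm (α β μ ν : ℝ) {s z : ℂ} (hs : 2 < s.re) (hz : 0 < z.im) :
    HasSum (meanTerm s α β μ ν z) (eisF s α β μ ν z) := by
  have h1 := (summable_norm_eisTerm (fun _ => norm_inv_powPlus_le s) α β μ ν hs
    hz).of_norm.hasSum
  have h2 := (summable_norm_eisTerm (fun _ => norm_inv_powMinus_le s) α β μ ν hs
    hz).of_norm.hasSum
  exact hasSum_subtype_iff_indicator.mp ((h1.add h2).div_const 2)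

/-! ### The two branches, and the sums over single rows. -/

lemma powMinus_eq_powPlus {u : ℂ} (hu : u.im ≠ 0) (s : ℂ) : powMinus u s = powPlus u s := by
  have : arg u ≠ Real.pi := fun h => hu (arg_eq_pi_iff.mp h).2
  rw [powMinus, powPlus, argMinus, if_neg this]

lemma powPlus_of_im_neg {u : ℂ} (hu : u.im < 0) (s : ℂ) :
    powPlus u s = exp (-Real.pi * I * s) * powPlus (-u) s := by
  have h := arg_neg_eq_arg_sub_pi_of_im_pos (x := -u) (by simpa using hu)
  rw [neg_neg] at h
  rw [powPlus, powPlus, norm_neg, h, ← Complex.exp_add]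
  congr 1
  push_cast
  ring

lemma powPlus_ofReal_of_pos {x : ℝ} (hx : 0 < x) (s : ℂ) :
    powPlus x s = ((|x| : ℝ) : ℂ) ^ s := by
  rw [powPlus, arg_ofReal_of_nonneg hx.le, norm_real, Real.norm_eq_abs, abs_of_pos hx,
    cpow_def_of_ne_zero (ofReal_ne_zero.mpr hx.ne'), ofReal_log hx.le]
  simp [mul_comm]

lemma powMinus_ofReal_of_pos {x : ℝ} (hx : 0 < x) (s : ℂ) :
    powMinus x s = ((|x| : ℝ) : ℂ) ^ s := by
  rw [← powPlus_ofReal_of_pos hx, powMinus, powPlus, argMinus, arg_ofReal_of_nonneg hx.le,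
    if_neg Real.pi_ne_zero.symm]

lemma powPlus_ofReal_of_neg {x : ℝ} (hx : x < 0) (s : ℂ) :
    powPlus x s = ((|x| : ℝ) : ℂ) ^ s * exp (Real.pi * s * I) := by
  rw [powPlus, arg_ofReal_of_neg hx, norm_real, Real.norm_eq_abs,
    cpow_def_of_ne_zero (ofReal_ne_zero.mpr (abs_pos.mpr hx.ne).ne'), ofReal_log (abs_nonneg x),
    ← Complex.exp_add]
  ring_nf

lemma powMinus_ofReal_of_neg {x : ℝ} (hx : x < 0) (s : ℂ) :
    powMinus x s = ((|x| : ℝ) : ℂ) ^ s * exp (-(Real.pi * s) * I) := by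
  rw [powMinus, argMinus, arg_ofReal_of_neg hx, if_pos rfl, norm_real, Real.norm_eq_abs,
    cpow_def_of_ne_zero (ofReal_ne_zero.mpr (abs_pos.mpr hx.ne).ne'), ofReal_log (abs_nonneg x),
    ← Complex.exp_add]
  push_cast
  ring_nf

lemma latticePt_im (α β : ℝ) (z : ℂ) (p : ℤ × ℤ) :
    (latticePt α β z p).im = (β + p.2) * z.im := by
  rw [latticePt, show (α + p.1 + (β + p.2) * z : ℂ) =
    ((α + p.1 : ℝ) : ℂ) + ((β + p.2 : ℝ) : ℂ) * z by push_cast; rfl, add_im, ofReal_im,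
    im_ofReal_mul, zero_add]

lemma meanTerm_of_ne (s : ℂ) (α β μ ν : ℝ) {z : ℂ} (hz : 0 < z.im) {p : ℤ × ℤ}
    (hp : β + p.2 ≠ 0) :
    meanTerm s α β μ ν z p = e ((β + p.2) * ν) *
      (e ((α + p.1) * μ) / powPlus (latticePt α β z p) s) := by
  have him : (latticePt α β z p).im ≠ 0 := by
    rw [latticePt_im]
    exact mul_ne_zero hp hz.ne'
  have hne : p ∈ {p : ℤ × ℤ | latticePt α β z p ≠ 0} := fun h => him (by simp [h])
  rw [meanTerm, indicator_of_mem hne, eisTerm, eisTerm, powMinus_eq_powPlus him, e_add]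
  ring

lemma hasSum_row_pos (α β μ ν : ℝ) {s z : ℂ} (hs : 1 < s.re) (hz : 0 < z.im) {n : ℤ}
    (hn : -β < n) :
    HasSum (fun m : ℤ => meanTerm s α β μ ν z (m, n))
      (e (α * μ) * ((2 * Real.pi : ℂ) ^ s * (Gamma s)⁻¹) * exp (-Real.pi * I * s / 2) *
        ∑' l : {l : ℤ // -(-μ) < l}, qTerm (1 - s) β (-μ) ν α z n l) := by
  have hn' : 0 < β + n := by linarith
  have hw : 0 < ((β + n : ℂ) * z).im := by
    rw [show (β + n : ℂ) = ((β + n : ℝ) : ℂ) by push_cast; rfl, im_ofReal_mul]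
    positivity
  have h := (hasSum_lipschitz (-μ) α hs hw).mul_left (e ((β + n) * ν))
  rw [mul_left_comm, ← tsum_mul_left] at h
  convert! h using 1
  · ext m
    rw [meanTerm_of_ne _ _ _ _ _ hz (by simpa using hn'.ne'), latticePt]
    push_cast
    ring_nf
  · congr 1
    · push_cast
      ring_nf
    · refine tsum_congr fun l => ?_
      rw [qTerm, e_add]
      push_cast
      ring_nf

lemma hasSum_row_neg (α β μ ν : ℝ) {s z : ℂ} (hs : 1 < s.re) (hz : 0 < z.im) {n : ℤ}
    (hn : -(-β) < (-n : ℤ)) :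
    HasSum (fun m : ℤ => meanTerm s α β μ ν z (m, n))
      (e (α * μ) * ((2 * Real.pi : ℂ) ^ s * (Gamma s)⁻¹) * exp (Real.pi * I * s / 2) *
        ∑' l : {l : ℤ // -μ < l}, qTerm (1 - s) (-β) μ (-ν) (-α) z (-n : ℤ) l) := by
  have hn' : β + n < 0 := by
    push_cast at hn
    linarith
  have hw : 0 < (-(β + n : ℂ) * z).im := by
    rw [show -(β + n : ℂ) = ((-(β + n) : ℝ) : ℂ) by push_cast; rfl, im_ofReal_mul]
    exact mul_pos (by linarith) hz
  -- Lipschitz's formula at the reflected points; the branch factor `exp (πis)` turns its `exp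
  -- (-πis/2)` into `exp (πis/2)`.
  have h := ((Equiv.neg ℤ).hasSum_iff.mpr (hasSum_lipschitz μ (-α) hs hw)).mul_left
    (exp (Real.pi * I * s) * e ((β + n) * ν))
  have hexp : exp (Real.pi * I * s) * exp (-Real.pi * I * s / 2) = exp (Real.pi * I * s / 2) := by
    rw [← Complex.exp_add]
    ring_nf
  convert! h using 1
  · ext m
    have him : (latticePt α β z (m, n)).im < 0 := by
      rw [latticePt_im]
      exact mul_neg_of_neg_of_pos hn' hz
    rw [meanTerm_of_ne _ _ _ _ _ hz (by simpa using hn'.ne), powPlus_of_im_neg him,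
      show (-Real.pi * I * s : ℂ) = -(Real.pi * I * s) by ring, Complex.exp_neg]
    simp only [Function.comp_apply, Equiv.neg_apply, latticePt]
    rw [show (((-α : ℝ) : ℂ) + ((-m : ℤ) : ℂ) + -(β + n : ℂ) * z) =
      -(α + m + (β + n) * z) by push_cast; ring,
      show -((((-α : ℝ) : ℂ) + ((-m : ℤ) : ℂ)) * μ) = (α + m) * μ by push_cast; ring]
    field_simp
  · rw [← hexp, show (-(((-α : ℝ) : ℂ) * μ)) = α * μ by push_cast; ring]
    have : ∑' l : {l : ℤ // -μ < l}, qTerm (1 - s) (-β) μ (-ν) (-α) z (-n : ℤ) l =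
        e ((β + n) * ν) * ∑' l : {l : ℤ // -μ < l}, e ((μ + l) * (-α : ℝ)) /
          ((μ + l : ℝ) : ℂ) ^ (1 - s) * e ((μ + l) * (-(β + n) * z)) := by
      rw [← tsum_mul_left]
      refine tsum_congr fun l => ?_
      rw [qTerm, e_add]
      push_cast
      ring_nf
    rw [this]
    ring

lemma hasSum_row_zero (α β μ ν : ℝ) {s : ℂ} (z : ℂ) (hs : 1 < s.re) {n : ℤ} (hn : β + n = 0) :
    HasSum (fun m : ℤ => meanTerm s α β μ ν z (m, n)) (calA s α μ) := by
  have hs1 : s ≠ 1 := fun h => by norm_num [h] at hs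
  have hs0 : s ≠ 0 := fun h => by norm_num [h] at hs
  have hn' : (β + n : ℂ) = 0 := by exact_mod_cast congrArg ((↑) : ℝ → ℂ) hn
  rw [calA_of_ne_one _ _ hs1, calA₀_eq _ _ hs1]
  refine (((hasSum_evenLerch α μ hs).mul_left (cos (Real.pi * s / 2) ^ 2)).add
    ((hasSum_oddLerch α μ hs).mul_left (sin (Real.pi * s / 2) ^ 2))).congr_fun fun m => ?_
  have hpt : latticePt α β z (m, n) = ((m + α : ℝ) : ℂ) := by
    simp only [latticePt, hn']
    push_cast
    ring
  have hterm (pow : ℂ → ℂ → ℂ) : eisTerm pow s α β μ ν z (m, n) =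
      e ((m + α : ℝ) * μ) / pow ((m + α : ℝ) : ℂ) s := by
    simp only [eisTerm, hpt, hn']
    push_cast
    ring_nf
  have hcos : cos (Real.pi * s) = cos (Real.pi * s / 2) ^ 2 - sin (Real.pi * s / 2) ^ 2 := by
    rw [show (Real.pi * s : ℂ) = 2 * (Real.pi * s / 2) by ring, Complex.cos_two_mul,
      show (2 * (Real.pi * s / 2) / 2 : ℂ) = Real.pi * s / 2 by ring, Complex.sin_sq]
    ring
  rw [meanTerm]
  -- At negative points the mean of `exp (∓πis)` is `cos (πs) = cos² - sin²`, matching the sign `-1`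
  -- in the odd series; at zero the Lerch terms vanish like the omitted lattice term.
  rcases lt_trichotomy (m + α : ℝ) 0 with hx | hx | hx
  · have hmem : (m, n) ∈ {p : ℤ × ℤ | latticePt α β z p ≠ 0} := by
      rw [mem_ofPred_eq, hpt]
      exact ofReal_ne_zero.mpr hx.ne
    rw [indicator_of_mem hmem, hterm, hterm, powPlus_ofReal_of_neg hx, powMinus_ofReal_of_neg hx,
      sign_neg hx, SignType.coe_neg_one]
    have hc : (exp (Real.pi * s * I))⁻¹ + (exp (-(Real.pi * s) * I))⁻¹ =
        2 * (cos (Real.pi * s / 2) ^ 2 - sin (Real.pi * s / 2) ^ 2) := by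
      rw [← hcos, two_cos, ← Complex.exp_neg, ← Complex.exp_neg]
      ring_nf
    rw [div_eq_mul_inv (e _), div_eq_mul_inv (e _), div_eq_mul_inv (e _), div_eq_mul_inv (e _ * _),
      mul_inv, mul_inv]
    linear_combination (e ((m + α : ℝ) * μ) * (((|m + α| : ℝ) : ℂ) ^ s)⁻¹ / 2) * hc
  · have hmem : (m, n) ∉ {p : ℤ × ℤ | latticePt α β z p ≠ 0} := by
      rw [mem_ofPred_eq, hpt, hx]
      simp
    rw [indicator_of_notMem hmem, hx]
    simp [hs0]
  · have hmem : (m, n) ∈ {p : ℤ × ℤ | latticePt α β z p ≠ 0} := by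
      rw [mem_ofPred_eq, hpt]
      exact ofReal_ne_zero.mpr hx.ne'
    rw [indicator_of_mem hmem, hterm, hterm, powPlus_ofReal_of_pos hx, powMinus_ofReal_of_pos hx,
      sign_pos hx, SignType.coe_one]
    linear_combination (-(e ((m + α : ℝ) * μ) / ((|m + α| : ℝ) : ℂ) ^ s)) *
      Complex.cos_sq_add_sin_sq (Real.pi * s / 2)

lemma hasSum_tsum_qTerm (r : ℂ) (γ δ κ lam : ℝ) {z : ℂ} (hz : 0 < z.im) :
    HasSum (fun k : {k : ℤ // -γ < k} => ∑' l : {l : ℤ // -δ < l}, qTerm r γ δ κ lam z k l)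
      (qSeries r γ δ κ lam z) := by
  have h := (summable_norm_qTerm r γ δ κ lam hz).of_norm
  rw [qSeries]
  generalize qTerm r γ δ κ lam z = B at *
  exact h.hasSum.prod_fiberwise fun k => (h.prod_factor k).hasSum

lemma hasSum_ite_add_eq_zero (β : ℝ) (c : ℂ) :
    HasSum (fun n : ℤ => if β + n = 0 then c else 0) (delta β * c) := by
  by_cases h : IsInt β
  · rw [delta_of_isInt h, one_mul]
    obtain ⟨k, rfl⟩ := h
    have := hasSum_ite_eq (-k) c
    refine this.congr_fun fun n => ?_
    have : ((k : ℝ) + n = 0) ↔ n = -k := by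
      rw [← Int.cast_add, Int.cast_eq_zero]
      lia
    simp only [this]
  · have h' (n : ℤ) : β + n ≠ 0 := fun h0 => h ⟨-n, by push_cast; linarith⟩
    simpa only [h', if_false, delta_of_not_isInt h, zero_mul] using hasSum_zero

/-- The continuation of the Eisenstein series. -/
def eisCont (α β μ ν : ℝ) (s z : ℂ) : ℂ :=
  delta β * calA s α μ +
    e (α * μ) * ((2 * Real.pi : ℂ) ^ s * (Gamma s)⁻¹) *
      (exp (-Real.pi * I * s / 2) * qSeries (1 - s) β (-μ) ν α z +
        exp (Real.pi * I * s / 2) * qSeries (1 - s) (-β) μ (-ν) (-α) z)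

lemma eisCont_eq_eisF (α β μ ν : ℝ) {s z : ℂ} (hs : 2 < s.re) (hz : 0 < z.im) :
    eisCont α β μ ν s z = eisF s α β μ ν z := by
  have hs1 : 1 < s.re := by linarith
  set K : ℂ := e (α * μ) * ((2 * Real.pi : ℂ) ^ s * (Gamma s)⁻¹)
  have h1 : HasSum ({n : ℤ | -β < n}.indicator fun n : ℤ => K * exp (-Real.pi * I * s / 2) *
      ∑' l : {l : ℤ // -(-μ) < l}, qTerm (1 - s) β (-μ) ν α z n l)
      (K * exp (-Real.pi * I * s / 2) * qSeries (1 - s) β (-μ) ν α z) :=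
    hasSum_subtype_iff_indicator.mp ((hasSum_tsum_qTerm (1 - s) β (-μ) ν α hz).mul_left _)
  have h2 : HasSum ({n : ℤ | -(-β) < n}.indicator (fun n : ℤ => K * exp (Real.pi * I * s / 2) *
      ∑' l : {l : ℤ // -μ < l}, qTerm (1 - s) (-β) μ (-ν) (-α) z n l) ∘ Equiv.neg ℤ)
      (K * exp (Real.pi * I * s / 2) * qSeries (1 - s) (-β) μ (-ν) (-α) z) :=
    (Equiv.neg ℤ).hasSum_iff.mpr (hasSum_subtype_iff_indicator.mp
      ((hasSum_tsum_qTerm (1 - s) (-β) μ (-ν) (-α) hz).mul_left _))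
  have h3 := hasSum_ite_add_eq_zero β (calA s α μ)
  have hF : HasSum (fun p : ℤ × ℤ => meanTerm s α β μ ν z (p.2, p.1)) (eisF s α β μ ν z) :=
    (Equiv.prodComm ℤ ℤ).hasSum_iff.mpr (hasSum_meanTerm α β μ ν hs hz)
  -- For each `n` exactly one of the three summands is active, according to the sign of `β + n`.
  have hrow := hF.prod_fiberwise (g := fun n : ℤ =>
    (if β + n = 0 then calA s α μ else 0) +
    ({n : ℤ | -β < n}.indicator (fun n : ℤ => K * exp (-Real.pi * I * s / 2) *
      ∑' l : {l : ℤ // -(-μ) < l}, qTerm (1 - s) β (-μ) ν α z n l) n +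
    {n : ℤ | -(-β) < n}.indicator (fun n : ℤ => K * exp (Real.pi * I * s / 2) *
      ∑' l : {l : ℤ // -μ < l}, qTerm (1 - s) (-β) μ (-ν) (-α) z n l) (-n))) fun n => ?_
  · rw [eisCont, ((h3.add (h1.add h2)).unique hrow).symm]
    ring
  · rcases lt_trichotomy (β + n) 0 with hn | hn | hn
    · have hneg : -(-β) < ((-n : ℤ) : ℝ) := by push_cast; linarith
      rw [if_neg hn.ne, indicator_of_notMem (show n ∉ {n : ℤ | -β < n} from
        fun h : -β < n => by linarith), indicator_of_mem (show -n ∈ {n : ℤ | -(-β) < n} from hneg),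
        zero_add, zero_add]
      exact hasSum_row_neg α β μ ν hs1 hz hneg
    · rw [if_pos hn, indicator_of_notMem (show n ∉ {n : ℤ | -β < n} from
        fun h : -β < n => by linarith), indicator_of_notMem (show -n ∉ {n : ℤ | -(-β) < n} from
        fun h : -(-β) < ((-n : ℤ) : ℝ) => by push_cast at h; linarith), add_zero, add_zero]
      exact hasSum_row_zero α β μ ν z hs1 hn
    · have hpos : -β < n := by linarith
      rw [if_neg hn.ne', indicator_of_mem (show n ∈ {n : ℤ | -β < n} from hpos),
        indicator_of_notMem (show -n ∉ {n : ℤ | -(-β) < n} from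
        fun h : -(-β) < ((-n : ℤ) : ℝ) => by push_cast at h; linarith), zero_add, add_zero]
      exact hasSum_row_pos α β μ ν hs1 hz hpos

lemma differentiable_eisCont (α β μ ν : ℝ) {z : ℂ} (hz : 0 < z.im) :
    Differentiable ℂ fun s => eisCont α β μ ν s z := by
  have h1 := differentiable_calA α μ
  have h2 := differentiable_qSeries_one_sub β (-μ) ν α hz
  have h3 := differentiable_qSeries_one_sub (-β) μ (-ν) (-α) hz
  have h4 : Differentiable ℂ fun s : ℂ => (Gamma s)⁻¹ := differentiable_one_div_Gamma
  have h5 : Differentiable ℂ fun s : ℂ => (2 * Real.pi : ℂ) ^ s :=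
    differentiable_id.const_cpow (.inl (by simp [Real.pi_ne_zero]))
  unfold eisCont
  fun_prop

lemma exp_isBigO_real_exp_add (c d : ℝ) (l : Filter ℂ) :
    (fun τ : ℂ => exp (c * τ)) =O[l] fun τ : ℂ => Real.exp (c * τ.re) + Real.exp (d * τ.re) := by
  refine IsBigO.of_bound 1 (.of_forall fun τ => ?_)
  rw [Complex.norm_exp, re_ofReal_mul, one_mul, Real.norm_of_nonneg (by positivity)]
  exact le_add_of_nonneg_right (Real.exp_pos _).le

lemma eisCont_sub_isBigO (α β μ ν : ℝ) (s : ℂ) {θ : ℝ} (hθ : θ < Real.pi / 2) {L L' : ℤ}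
    (hL : ⌊μ⌋ ≤ L) (hL' : ⌊-μ⌋ ≤ L') :
    (fun τ : ℂ => eisCont α β μ ν s (I * τ) - (delta β * calA s α μ +
      e (α * μ) * ((2 * Real.pi : ℂ) ^ s * (Gamma s)⁻¹) *
        (exp (-Real.pi * I * s / 2) * qPartialSum (1 - s) β (-μ) ν α (I * τ) L +
          exp (Real.pi * I * s / 2) * qPartialSum (1 - s) (-β) μ (-ν) (-α) (I * τ) L')))
      =O[atInftySector θ]
      fun τ : ℂ => Real.exp (-2 * Real.pi * fracPrime β * (-μ + (L + 1)) * τ.re) +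
        Real.exp (-2 * Real.pi * fracPrime (-β) * (μ + (L' + 1)) * τ.re) := by
  have h1 := qSeries_sub_qPartialSum_isBigO (1 - s) β (-μ) ν α hθ (L := L) (by rwa [neg_neg])
  have h2 := qSeries_sub_qPartialSum_isBigO (1 - s) (-β) μ (-ν) (-α) hθ hL'
  have b1 := exp_isBigO_real_exp_add (-2 * Real.pi * fracPrime β * (-μ + (L + 1)))
    (-2 * Real.pi * fracPrime (-β) * (μ + (L' + 1))) (atInftySector θ)
  have b2 := exp_isBigO_real_exp_add (-2 * Real.pi * fracPrime (-β) * (μ + (L' + 1)))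
    (-2 * Real.pi * fracPrime β * (-μ + (L + 1))) (atInftySector θ)
  simp_rw [add_comm (Real.exp (-2 * Real.pi * fracPrime (-β) * (μ + (L' + 1)) * _))] at b2
  push_cast at h1 h2 b1 b2
  have h := ((h1.trans b1).const_mul_left (e (α * μ) * ((2 * Real.pi : ℂ) ^ s * (Gamma s)⁻¹) *
    exp (-Real.pi * I * s / 2))).add ((h2.trans b2).const_mul_left (e (α * μ) *
      ((2 * Real.pi : ℂ) ^ s * (Gamma s)⁻¹) * exp (Real.pi * I * s / 2)))
  refine h.congr_left fun τ => ?_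
  rw [eisCont]
  ring

end

end HolEis

theorem theorem1 (α β μ ν : ℝ) :
    -- the Lerch zeta-functions have their continuations
    (∀ γ κ : ℝ, IsLerchPsi γ κ fun r => lerchPsi r γ κ) ∧
    -- `𝓐` is entire and has the two expressions
    (Differentiable ℂ fun s => calA s α μ) ∧
    (∀ s : ℂ, s ≠ 1 ∨ ¬ IsInt μ →
      calA s α μ = cos (Real.pi * s) * lerchPsi s (-α) (-μ) + lerchPsi s α μ) ∧
    (∀ s : ℂ, s ≠ 0 ∨ ¬ IsInt α →
      calA s α μ = e (α * μ) * ((2 * Real.pi : ℂ) ^ s * (2 * Gamma s)⁻¹) *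
        (exp (-Real.pi * I * s / 2) * lerchPsi (1 - s) (-μ) α +
          exp (Real.pi * I * s / 2) * lerchPsi (1 - s) μ (-α))) ∧
    -- the defining series converge absolutely for `Re s > 2`
    (∀ s z : ℂ, 2 < s.re → 0 < z.im →
      Summable (fun p : {p : ℤ × ℤ // latticePt α β z p ≠ 0} =>
        ‖eisTerm powPlus s α β μ ν z p‖) ∧
      Summable (fun p : {p : ℤ × ℤ // latticePt α β z p ≠ 0} =>
        ‖eisTerm powMinus s α β μ ν z p‖)) ∧
    -- the `q`-series converge absolutely for all `s`
    (∀ s z : ℂ, 0 < z.im →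
      Summable (fun p : QIndex β (-μ) => ‖qTerm (1 - s) β (-μ) ν α z p.1 p.2‖) ∧
      Summable (fun p : QIndex (-β) μ => ‖qTerm (1 - s) (-β) μ (-ν) (-α) z p.1 p.2‖)) ∧
    -- they are convergent asymptotic series as `τ → ∞`
    (∀ s : ℂ, IsAsymptoticQSeries (1 - s) β (-μ) ν α ∧
      IsAsymptoticQSeries (1 - s) (-β) μ (-ν) (-α)) ∧
    -- the transformation formula, the continuation `F` and its asymptotic series
    ∃ F : ℂ → ℂ → ℂ,
      (∀ z : ℂ, 0 < z.im → Differentiable ℂ fun s => F s z) ∧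
      (∀ s z : ℂ, 2 < s.re → 0 < z.im → F s z = eisF s α β μ ν z) ∧
      (∀ s z : ℂ, 0 < z.im →
        F s z = delta β * calA s α μ +
          e (α * μ) * ((2 * Real.pi : ℂ) ^ s * (Gamma s)⁻¹) *
            (exp (-Real.pi * I * s / 2) * qSeries (1 - s) β (-μ) ν α z +
              exp (Real.pi * I * s / 2) * qSeries (1 - s) (-β) μ (-ν) (-α) z)) ∧
      (∀ s : ℂ, ∀ θ < Real.pi / 2, ∀ L L' : ℤ, ⌊μ⌋ ≤ L → ⌊-μ⌋ ≤ L' →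
        (fun τ : ℂ => F s (I * τ) - (delta β * calA s α μ +
          e (α * μ) * ((2 * Real.pi : ℂ) ^ s * (Gamma s)⁻¹) *
            (exp (-Real.pi * I * s / 2) * qPartialSum (1 - s) β (-μ) ν α (I * τ) L +
              exp (Real.pi * I * s / 2) * qPartialSum (1 - s) (-β) μ (-ν) (-α) (I * τ) L')))
          =O[atInftySector θ]
          fun τ : ℂ => Real.exp (-2 * Real.pi * fracPrime β * (-μ + (L + 1)) * τ.re) +
            Real.exp (-2 * Real.pi * fracPrime (-β) * (μ + (L' + 1)) * τ.re)) := by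
  refine ⟨isLerchPsi_lerchPsi, differentiable_calA α μ, fun s hs => calA_eq_calA₀ α μ hs,
    fun s hs => calA_eq_dual α μ hs,
    fun s z hs hz => ⟨summable_norm_eisTerm (fun _ => norm_inv_powPlus_le s) α β μ ν hs hz,
      summable_norm_eisTerm (fun _ => norm_inv_powMinus_le s) α β μ ν hs hz⟩,
    fun s z hz => ⟨summable_norm_qTerm _ _ _ _ _ hz, summable_norm_qTerm _ _ _ _ _ hz⟩,
    fun s => ⟨isAsymptoticQSeries _ _ _ _ _, isAsymptoticQSeries _ _ _ _ _⟩,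
    eisCont α β μ ν, fun z hz => differentiable_eisCont α β μ ν hz,
    fun s z hs hz => eisCont_eq_eisF α β μ ν hs hz, fun s z _ => rfl,
    fun s θ hθ L L' hL hL' => eisCont_sub_isBigO α β μ ν s hθ hL hL'⟩
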